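/- Let $(M,g)$ be a smooth 4-dimensional Lorentzian manifold of signature $(-+++)$, with Levi-Civita connection $\nabla$ and with Levi-Civita tensor (metric volume form) $\epsilon_{\alpha\beta\gamma\delta}$ for a choice of orientation. The Riemann tensor is normalized by $[\nabla_\alpha,\nabla_\beta]A_\mu=-R^\lambda{}_{\mu\alpha\beta}A_\lambda$, the Ricci tensor is $R_{\mu\nu}=R^\lambda{}_{\mu\lambda\nu}$, the scalar curvature is $R=g^{\mu\nu}R_{\mu\nu}$ and the Einstein tensor is $G_{\mu\nu}=R_{\mu\nu}-\tfrac12 R\,g_{\mu\nu}$. Round brackets denote symmetrization with total weight one over the enclosed indices (an index summed over is never symmetrized), a semicolon denotes the covariant derivative, $\xi_{\alpha;\lambda}=\nabla_\lambda\xi_\alpha$, and $\Delta=g^{\mu\nu}\nabla_\mu\nabla_\nu$. Let $Y$ be a smooth Killing–Yano tensor on $M$: $Y_{\mu\nu}=-Y_{\nu\mu}$ and $\nabla_{(\alpha}Y_{\beta)\gamma}=0$. Set $$Y^*_{\mu\nu}=\tfrac12\epsilon_{\mu\nu}{}^{\rho\sigma}Y_{\rho\sigma},\quad R^{*\lambda}{}_{\gamma\delta\alpha}=\tfrac12\epsilon_{\delta\alpha}{}^{\rho\sigma}R^\lambda{}_{\gamma\rho\sigma},\quad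 K_{\alpha\beta}=Y_{\alpha\lambda}Y^\lambda{}_\beta,\quad \xi^\alpha=-\tfrac13\nabla_\lambda Y^{*\lambda\alpha},\quad \mathcal Z=\tfrac14 Y^*_{\alpha\beta}Y^{\alpha\beta}.$$ Then the following hold at every point of $M$. 1. (Central identity) $$K_{\lambda(\beta}R^{*\lambda}{}_{\gamma\delta)\alpha}=Y^\lambda{}_{(\beta}g_{\gamma\delta)}\xi_{\alpha;\lambda}-g_{\alpha(\beta}Y^\lambda{}_{\gamma}\xi_{\delta);\lambda}+\tfrac12Y_{\alpha(\beta}Y^{*\lambda}{}_{\gamma}G_{\delta)\lambda},$$ where $\beta,\gamma,\delta$ are symmetrized. 2. (Reduced central identity) $$R^{*\lambda}{}_{\nu\mu}{}^{\rho}K_{\lambda\rho}=4\nabla_\mu\nabla_\nu\mathcal Z-g_{\mu\nu}\Delta\mathcal Z-Y^{*\lambda}{}_{(\rho}G_{\mu)\lambda}Y^\rho{}_\nu+G^\beta{}_\lambda Y^\lambda{}_\nu Y^*_{\mu\beta}+\mathcal Z\,G_{\mu\nu}.$$ 3. If $(M,g)$ is Ricci-flat, that is $R_{\mu\nu}=0$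 on $M$, then $$K_{\lambda(\beta}R^{*\lambda}{}_{\gamma\delta)\alpha}=-\nabla_\alpha\nabla_{(\beta}\mathcal Z\,g_{\gamma\delta)}+g_{\alpha(\beta}\nabla_\gamma\nabla_{\delta)}\mathcal Z\qquad\text{and}\qquad R^{*\lambda}{}_{\mu\nu}{}^{\rho}K_{\lambda\rho}=4\nabla_\mu\nabla_\nu\mathcal Z-g_{\mu\nu}\Delta\mathcal Z.$$ -/

import Mathlib

open scoped Manifold ContDiff

noncomputable section

namespace Spacetime

/-- The model space `ℝ⁴`. -/
abbrev E4 : Type := EuclideanSpace ℝ (Fin 4)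

/-! ### Tensor fields on a 4-manifold and their components in a chart -/

section Manifold

variable {M : Type*} [TopologicalSpace M] [ChartedSpace E4 M]

/-- A (not necessarily smooth) covariant tensor field of rank `k` on `M`: a `k`-linear form on
every tangent space. -/
abbrev CovTensor (M : Type*) [TopologicalSpace M] [ChartedSpace E4 M] (k : ℕ) : Type _ :=
  ∀ p : M, MultilinearMap ℝ (fun _ : Fin k => TangentSpace (𝓡 4) p) ℝ

/-- The coordinate vector `∂_μ` of the chart `e`, at the point with coordinates `y`. -/
def coordVec (e : OpenPartialHomeomorph M E4) (y : E4) (μ : Fin 4) :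
    TangentSpace (𝓡 4) (e.symm y) :=
  mfderiv (𝓡 4) (𝓡 4) e.symm y (EuclideanSpace.single μ (1 : ℝ) : E4)

/-- The component `T_{i₀ … i_{k-1}} = T(∂_{i₀}, …, ∂_{i_{k-1}})` of `T` in the chart `e`, as a
function of the coordinates `y`. -/
def comp {k : ℕ} (e : OpenPartialHomeomorph M E4) (T : CovTensor M k) (i : Fin k → Fin 4)
    (y : E4) : ℝ :=
  T (e.symm y) (fun a => coordVec e y (i a))

/-- A tensor field is smooth if its components in every smooth chart are smooth functions of the
coordinates. -/
def IsSmoothTensor {k : ℕ} (T : CovTensor M k) : Prop :=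
  ∀ e ∈ IsManifold.maximalAtlas (𝓡 4) ∞ M, ∀ i : Fin k → Fin 4,
    ContDiffOn ℝ ∞ (comp e T i) e.target

/-- The components of a tensor field of rank 2 in the chart `e`. -/
def comp2 (e : OpenPartialHomeomorph M E4) (T : CovTensor M 2) (μ ν : Fin 4) : E4 → ℝ :=
  comp e T ![μ, ν]

/-- The components of a tensor field of rank 4 in the chart `e`. -/
def comp4 (e : OpenPartialHomeomorph M E4) (T : CovTensor M 4) (μ ν ρ σ : Fin 4) : E4 → ℝ :=
  comp e T ![μ, ν, ρ, σ]

end Manifold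

/-! ### Tensor calculus in coordinates

Coordinate components are functions on `ℝ⁴`, with the indices as arguments. In each definition
`g` stands for the components `g_{μν}` of the metric. -/

/-- The partial derivative `∂_μ f`. -/
def pd (μ : Fin 4) (f : E4 → ℝ) (y : E4) : ℝ :=
  fderiv ℝ f y (EuclideanSpace.single μ (1 : ℝ))

/-- The inverse metric `g^{μν}`. -/
def ginv (g : Fin 4 → Fin 4 → E4 → ℝ) (μ ν : Fin 4) (y : E4) : ℝ :=
  (Matrix.of fun a b => g a b y)⁻¹ μ ν

/-- The Christoffel symbols `Γ^l_{mn}` of the Levi-Civita connection. -/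
def christoffel (g : Fin 4 → Fin 4 → E4 → ℝ) (l m n : Fin 4) (y : E4) : ℝ :=
  (1 / 2) * ∑ s, ginv g l s y * (pd m (g s n) y + pd n (g s m) y - pd s (g m n) y)

/-- `∇_α A_β`. -/
def nabla1 (g : Fin 4 → Fin 4 → E4 → ℝ) (A : Fin 4 → E4 → ℝ) (α β : Fin 4) (y : E4) : ℝ :=
  pd α (A β) y - ∑ l, christoffel g l α β y * A l y

/-- `∇_α A_{βγ}`. -/
def nabla2 (g : Fin 4 → Fin 4 → E4 → ℝ) (A : Fin 4 → Fin 4 → E4 → ℝ) (α β γ : Fin 4)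
    (y : E4) : ℝ :=
  pd α (A β γ) y - ∑ l, christoffel g l α β y * A l γ y - ∑ l, christoffel g l α γ y * A β l y

/-- The second covariant derivative `∇_α ∇_β f` of a scalar. -/
def hess (g : Fin 4 → Fin 4 → E4 → ℝ) (f : E4 → ℝ) (α β : Fin 4) (y : E4) : ℝ :=
  nabla1 g (fun b => pd b f) α β y

/-- The d'Alembertian `Δ f = g^{αβ} ∇_α ∇_β f`. -/
def box (g : Fin 4 → Fin 4 → E4 → ℝ) (f : E4 → ℝ) (y : E4) : ℝ :=
  ∑ α, ∑ β, ginv g α β y * hess g f α β y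

/-- The Riemann tensor `R^l_{mab}`, normalized by `[∇_a, ∇_b] A_m = - R^l_{mab} A_l`. -/
def riemann (g : Fin 4 → Fin 4 → E4 → ℝ) (l m a b : Fin 4) (y : E4) : ℝ :=
  pd a (christoffel g l b m) y - pd b (christoffel g l a m) y
    + ∑ s, (christoffel g l a s y * christoffel g s b m y
        - christoffel g l b s y * christoffel g s a m y)

/-- The Ricci tensor `R_{mn} = R^l_{mln}`. -/
def ricci (g : Fin 4 → Fin 4 → E4 → ℝ) (m n : Fin 4) (y : E4) : ℝ :=
  ∑ l, riemann g l m l n y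

/-- The scalar curvature `R = g^{mn} R_{mn}`. -/
def scalarCurv (g : Fin 4 → Fin 4 → E4 → ℝ) (y : E4) : ℝ :=
  ∑ m, ∑ n, ginv g m n y * ricci g m n y

/-- The Einstein tensor `G_{mn} = R_{mn} - (R / 2) g_{mn}`. -/
def einstein (g : Fin 4 → Fin 4 → E4 → ℝ) (m n : Fin 4) (y : E4) : ℝ :=
  ricci g m n y - scalarCurv g y / 2 * g m n y

/-- Raising the first index of a rank 2 tensor: `A^μ_ν = g^{μλ} A_{λν}`. -/
def raiseFst (g A : Fin 4 → Fin 4 → E4 → ℝ) (μ ν : Fin 4) (y : E4) : ℝ :=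
  ∑ l, ginv g μ l y * A l ν y

/-- Raising both indices of a rank 2 tensor: `A^{μν} = g^{μλ} g^{νκ} A_{λκ}`. -/
def raiseBoth (g A : Fin 4 → Fin 4 → E4 → ℝ) (μ ν : Fin 4) (y : E4) : ℝ :=
  ∑ l, ∑ k, ginv g μ l y * ginv g ν k y * A l k y

/-- `ε_{μν}^{ρσ}`. -/
def epsMixed (g : Fin 4 → Fin 4 → E4 → ℝ) (ε : Fin 4 → Fin 4 → Fin 4 → Fin 4 → E4 → ℝ)
    (μ ν ρ σ : Fin 4) (y : E4) : ℝ :=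
  ∑ k, ∑ t, ε μ ν k t y * ginv g k ρ y * ginv g t σ y

/-- The Hodge dual `A*_{μν} = ½ ε_{μν}^{ρσ} A_{ρσ}`. -/
def dual2 (g : Fin 4 → Fin 4 → E4 → ℝ) (ε : Fin 4 → Fin 4 → Fin 4 → Fin 4 → E4 → ℝ)
    (A : Fin 4 → Fin 4 → E4 → ℝ) (μ ν : Fin 4) (y : E4) : ℝ :=
  (1 / 2) * ∑ ρ, ∑ σ, epsMixed g ε μ ν ρ σ y * A ρ σ y

/-- The right Hodge dual of the Riemann tensor, `R*^l_{mab} = ½ ε_{ab}^{ρσ} R^l_{mρσ}`. -/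
def riemannDual (g : Fin 4 → Fin 4 → E4 → ℝ) (ε : Fin 4 → Fin 4 → Fin 4 → Fin 4 → E4 → ℝ)
    (l m a b : Fin 4) (y : E4) : ℝ :=
  (1 / 2) * ∑ ρ, ∑ σ, epsMixed g ε a b ρ σ y * riemann g l m ρ σ y

/-- `K_{αβ} = Y_{αλ} Y^λ_β`. -/
def tensorK (g Y : Fin 4 → Fin 4 → E4 → ℝ) (α β : Fin 4) (y : E4) : ℝ :=
  ∑ l, Y α l y * raiseFst g Y l β y

/-- `ξ_α = -⅓ ∇^λ Y*_{λα}`. -/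
def xi (g : Fin 4 → Fin 4 → E4 → ℝ) (ε : Fin 4 → Fin 4 → Fin 4 → Fin 4 → E4 → ℝ)
    (Y : Fin 4 → Fin 4 → E4 → ℝ) (α : Fin 4) (y : E4) : ℝ :=
  -(1 / 3) * ∑ l, ∑ k, ginv g l k y * nabla2 g (dual2 g ε Y) k l α y

/-- `𝒵 = ¼ Y*_{αβ} Y^{αβ}`. -/
def scalarZ (g : Fin 4 → Fin 4 → E4 → ℝ) (ε : Fin 4 → Fin 4 → Fin 4 → Fin 4 → E4 → ℝ)
    (Y : Fin 4 → Fin 4 → E4 → ℝ) (y : E4) : ℝ :=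
  (1 / 4) * ∑ α, ∑ β, dual2 g ε Y α β y * raiseBoth g Y α β y

/-- Symmetrization over two indices, with weight `1/2`. -/
def sym2 (T : Fin 4 → Fin 4 → ℝ) (β γ : Fin 4) : ℝ :=
  (1 / 2) * (T β γ + T γ β)

/-- Symmetrization over three indices, with weight `1/6`. -/
def sym3 (T : Fin 4 → Fin 4 → Fin 4 → ℝ) (β γ δ : Fin 4) : ℝ :=
  (1 / 6) * (T β γ δ + T β δ γ + T γ β δ + T γ δ β + T δ β γ + T δ γ β)

/-! ### Geometric structures on `M` -/

section Structures

variable {M : Type*} [TopologicalSpace M] [ChartedSpace E4 M]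

/-- A smooth Lorentzian metric of signature `(-+++)`: a smooth symmetric tensor field that has an
orthonormal basis with `g(b₀, b₀) = -1` and `g(bᵢ, bᵢ) = 1` for `i ≠ 0` at every point. -/
def IsLorentzMetric (g : CovTensor M 2) : Prop :=
  IsSmoothTensor g ∧
  (∀ (p : M) (u v : TangentSpace (𝓡 4) p), g p ![u, v] = g p ![v, u]) ∧
  ∀ p : M, ∃ b : Module.Basis (Fin 4) ℝ (TangentSpace (𝓡 4) p), ∀ i j : Fin 4,
    g p ![b i, b j] = if i = j then (if i = 0 then -1 else 1) else 0

/-- A Levi-Civita tensor (metric volume form) of `g`: a smooth totally antisymmetric tensor field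
of rank 4 with `ε(v₀, v₁, v₂, v₃)² = -det g(vᵢ, vⱼ)`; that is, `ε_{0123} = ± √(-det g_{μν})` in
every chart. The choice of the sign is the choice of the orientation. -/
def IsVolumeForm (g : CovTensor M 2) (ε : CovTensor M 4) : Prop :=
  IsSmoothTensor ε ∧
  (∀ (p : M) (v : Fin 4 → TangentSpace (𝓡 4) p) (i j : Fin 4), v i = v j → i ≠ j →
    ε p v = 0) ∧
  ∀ (p : M) (v : Fin 4 → TangentSpace (𝓡 4) p),
    ε p v ^ 2 = -(Matrix.of fun i j : Fin 4 => g p ![v i, v j]).det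

/-- A Killing-Yano tensor: a smooth antisymmetric tensor field of rank 2 with
`∇_{(α} Y_{β)γ} = 0`. -/
def IsKillingYano (g Y : CovTensor M 2) : Prop :=
  IsSmoothTensor Y ∧
  (∀ (p : M) (u v : TangentSpace (𝓡 4) p), Y p ![u, v] = -Y p ![v, u]) ∧
  ∀ e ∈ IsManifold.maximalAtlas (𝓡 4) ∞ M, ∀ y ∈ e.target, ∀ α β γ : Fin 4,
    sym2 (fun α β => nabla2 (comp2 e g) (comp2 e Y) α β γ y) α β = 0

/-- `R_{αβ} = 0` everywhere on `M`. -/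
def IsRicciFlat (g : CovTensor M 2) : Prop :=
  ∀ e ∈ IsManifold.maximalAtlas (𝓡 4) ∞ M, ∀ y ∈ e.target, ∀ α β : Fin 4,
    ricci (comp2 e g) α β y = 0

end Structures

end Spacetime

end

/-! For a Killing–Yano tensor `∇Y` is totally antisymmetric, and in dimension 4 a 3-form is a vector
contracted with the volume form. The normalization of `ξ` makes it that vector: `∇_a Y_{bc} =
ε_{abcl} ξ^l`. The Hodge dual commutes with `∇`, so `h = Y*` satisfies `∇_a h_{bc} = g_{ca} ξ_b -
g_{ba} ξ_c` (`nabla2_eq_and_dual`). One more derivative and the Ricci identity express the action of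
the curvature on `h` through `g` and `D = ∇ξ` (`integrability`). The other differential facts needed
are `∇_c 𝒵 = Y^b_c ξ_b` and `∇_a ∇_b 𝒵 = Y^l_b ∇_a ξ_l`. The rest is algebra at one point, with the
data collected in `IsKillingYanoJet`.

Traces of the integrability condition show that `D` is trace-free and that its symmetric part is a
product of the Ricci tensor and `h` (`trace_eq_zero`, `add_swap`). The Hodge dual commutes with the
action of skew endomorphisms, so dualizing the form indices replaces `h` by `Y`, and dualizing the
curvature pair replaces `R` by `R*` (`dual_integrable`).

Contracting this with a second `Y` produces `K_{λb} R*^λ_{cda}` and a term `Y Y R*` that is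
antisymmetric in `b, c`, since `R*` is antisymmetric in its first pair. Symmetrization removes that
term, and the symmetric part of `D` becomes the Einstein term: this is `central_identity`. For the
reduced identity the index `a` is contracted instead. The first Bianchi identity kills one trace of
`R*`, the remaining products `Y D` are Hessians of `𝒵` up to the symmetric part of `D`, and `h^l_k
Y^k_n = -𝒵 δ^l_n` yields the term `𝒵 G_{μν}`. In the Ricci-flat case `D` is antisymmetric and all
Einstein terms vanish. -/

namespace Spacetime

variable {U : Set E4} {f f₁ f₂ : E4 → ℝ} {y : E4}

/-! ### Partial derivatives -/

theorem pd_add (μ : Fin 4) (h₁ : DifferentiableAt ℝ f₁ y) (h₂ : DifferentiableAt ℝ f₂ y) :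
    pd μ (fun x => f₁ x + f₂ x) y = pd μ f₁ y + pd μ f₂ y := by
  simp [pd, fderiv_fun_add h₁ h₂]

theorem pd_sub (μ : Fin 4) (h₁ : DifferentiableAt ℝ f₁ y) (h₂ : DifferentiableAt ℝ f₂ y) :
    pd μ (fun x => f₁ x - f₂ x) y = pd μ f₁ y - pd μ f₂ y := by
  simp [pd, fderiv_fun_sub h₁ h₂]

theorem pd_mul (μ : Fin 4) (h₁ : DifferentiableAt ℝ f₁ y) (h₂ : DifferentiableAt ℝ f₂ y) :
    pd μ (fun x => f₁ x * f₂ x) y = pd μ f₁ y * f₂ y + f₁ y * pd μ f₂ y := by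
  simp [pd, fderiv_fun_mul h₁ h₂]; ring

theorem pd_neg (μ : Fin 4) : pd μ (fun x => -f x) y = -pd μ f y := by
  simp [pd, fderiv_fun_neg]

theorem pd_const (μ : Fin 4) (c : ℝ) : pd μ (fun _ => c) y = 0 := by
  simp [pd]

theorem pd_const_mul (μ : Fin 4) (c : ℝ) (h : DifferentiableAt ℝ f y) :
    pd μ (fun x => c * f x) y = c * pd μ f y := by
  simp [pd, fderiv_const_mul h]

theorem pd_sum (μ : Fin 4) {F : Fin 4 → E4 → ℝ} (h : ∀ i, DifferentiableAt ℝ (F i) y) :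
    pd μ (fun x => ∑ i, F i x) y = ∑ i, pd μ (F i) y := by
  simp [pd, fderiv_fun_sum (fun i _ => h i)]

theorem pd_congr (μ : Fin 4) (hU : IsOpen U) (hy : y ∈ U) (h : ∀ x ∈ U, f₁ x = f₂ x) :
    pd μ f₁ y = pd μ f₂ y := by
  have : f₁ =ᶠ[nhds y] f₂ := Filter.eventually_of_mem (hU.mem_nhds hy) h
  simp [pd, this.fderiv_eq]

theorem contDiffOn_pd (hU : IsOpen U) (hf : ContDiffOn ℝ ∞ f U) (μ : Fin 4) :
    ContDiffOn ℝ ∞ (pd μ f) U :=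
  (hf.fderiv_of_isOpen hU (by simp)).clm_apply contDiffOn_const

theorem differentiableAt_of_contDiffOn (hU : IsOpen U) (hf : ContDiffOn ℝ ∞ f U) (hy : y ∈ U) :
    DifferentiableAt ℝ f y :=
  (hf.contDiffAt (hU.mem_nhds hy)).differentiableAt (by simp)

theorem pd_comm (hU : IsOpen U) (hf : ContDiffOn ℝ ∞ f U) (hy : y ∈ U) (μ ν : Fin 4) :
    pd μ (pd ν f) y = pd ν (pd μ f) y := by
  have hc := hf.contDiffAt (hU.mem_nhds hy)
  have hd : DifferentiableAt ℝ (fderiv ℝ f) y :=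
    (hc.fderiv_right (m := ∞) (by simp)).differentiableAt (by simp)
  have hs : IsSymmSndFDerivAt ℝ f y := hc.isSymmSndFDerivAt (by simpa using ENat.LEInfty.out)
  have key : ∀ a b : Fin 4, pd a (pd b f) y =
      fderiv ℝ (fderiv ℝ f) y (EuclideanSpace.single a 1) (EuclideanSpace.single b 1) := by
    intro a b
    show fderiv ℝ (fun x => fderiv ℝ f x (EuclideanSpace.single b 1)) y _ = _
    rw [fderiv_clm_apply hd (differentiableAt_const _)]
    simp
  rw [key, key, hs.eq]

/-! ### Metrics in a chart -/

/-- The components `g_{μν}` of a metric on the range `U` of a chart. -/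
structure IsChartMetric (U : Set E4) (g : Fin 4 → Fin 4 → E4 → ℝ) : Prop where
  isOpen : IsOpen U
  smooth : ∀ a b, ContDiffOn ℝ ∞ (g a b) U
  symm : ∀ a b, ∀ y ∈ U, g a b y = g b a y
  det_ne : ∀ y ∈ U, (Matrix.of fun a b => g a b y).det ≠ 0

variable {g : Fin 4 → Fin 4 → E4 → ℝ}

namespace IsChartMetric

theorem ginv_symm (hg : IsChartMetric U g) (hy : y ∈ U) (a b : Fin 4) :
    ginv g a b y = ginv g b a y := by
  have : (Matrix.of fun a b => g a b y).transpose = Matrix.of fun a b => g a b y := by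
    ext a b; exact hg.symm b a y hy
  unfold ginv
  conv_lhs => rw [← this, ← Matrix.transpose_nonsing_inv]
  rfl

theorem sum_ginv_mul (hg : IsChartMetric U g) (hy : y ∈ U) (a b : Fin 4) :
    ∑ l, ginv g a l y * g l b y = if a = b then 1 else 0 := by
  have := congrFun (congrFun (Matrix.nonsing_inv_mul (Matrix.of fun a b => g a b y)
    (hg.det_ne y hy).isUnit) a) b
  rwa [Matrix.mul_apply, Matrix.one_apply] at this

theorem sum_mul_ginv (hg : IsChartMetric U g) (hy : y ∈ U) (a b : Fin 4) :
    ∑ l, g a l y * ginv g l b y = if a = b then 1 else 0 := by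
  have := congrFun (congrFun (Matrix.mul_nonsing_inv (Matrix.of fun a b => g a b y)
    (hg.det_ne y hy).isUnit) a) b
  rwa [Matrix.mul_apply, Matrix.one_apply] at this

theorem contDiffOn_det {n : ℕ} {A : Fin n → Fin n → E4 → ℝ}
    (hA : ∀ a b, ContDiffOn ℝ ∞ (A a b) U) :
    ContDiffOn ℝ ∞ (fun y => (Matrix.of fun a b => A a b y).det) U := by
  simp only [Matrix.det_apply', Matrix.of_apply]
  exact ContDiffOn.sum fun σ _ => contDiffOn_const.mul (contDiffOn_prod fun i _ => hA _ _)

theorem contDiffOn_ginv (hg : IsChartMetric U g) (a b : Fin 4) :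
    ContDiffOn ℝ ∞ (ginv g a b) U := by
  -- Cramer's rule: smoothness of the inverse reduces to smoothness of determinants.
  have h1 : ginv g a b = fun y => ((Matrix.of fun a b => g a b y).det)⁻¹ *
      (Matrix.of fun i j => (if i = b then (if j = a then (1 : ℝ) else 0) else g i j y)).det := by
    funext y
    simp only [ginv, Matrix.inv_def, Ring.inverse_eq_inv', Matrix.smul_apply, smul_eq_mul,
      Matrix.adjugate_apply]
    congr 2
    ext i j
    by_cases h : i = b
    · subst h; simp [Pi.single_apply]
    · simp [h]
  rw [h1]
  refine ((contDiffOn_det hg.smooth).inv hg.det_ne).mul ?_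
  apply contDiffOn_det (A := fun i j y => if i = b then (if j = a then (1 : ℝ) else 0) else g i j y)
  intro i j
  by_cases h : i = b
  · simp only [h, if_true]; exact contDiffOn_const
  · simp only [h, if_false]; exact hg.smooth i j

theorem contDiffOn_pd (hg : IsChartMetric U g) (hf : ContDiffOn ℝ ∞ f U) (μ : Fin 4) :
    ContDiffOn ℝ ∞ (pd μ f) U :=
  Spacetime.contDiffOn_pd hg.isOpen hf μ

theorem contDiffOn_christoffel (hg : IsChartMetric U g) (l m n : Fin 4) :
    ContDiffOn ℝ ∞ (christoffel g l m n) U := by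
  have h1 := hg.contDiffOn_ginv
  have h2 := fun a b c => hg.contDiffOn_pd (hg.smooth a b) c
  unfold christoffel
  fun_prop

theorem contDiffOn_nabla2 (hg : IsChartMetric U g) {A : Fin 4 → Fin 4 → E4 → ℝ}
    (hA : ∀ a b, ContDiffOn ℝ ∞ (A a b) U) (a b c : Fin 4) :
    ContDiffOn ℝ ∞ (nabla2 g A a b c) U := by
  have h1 := hg.contDiffOn_christoffel
  have h2 := fun a b c => hg.contDiffOn_pd (hA a b) c
  unfold nabla2
  fun_prop

theorem contDiffOn_dual2 (hg : IsChartMetric U g) {A : Fin 4 → Fin 4 → E4 → ℝ}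
    {ε : Fin 4 → Fin 4 → Fin 4 → Fin 4 → E4 → ℝ}
    (hε : ∀ a b c d, ContDiffOn ℝ ∞ (ε a b c d) U)
    (hA : ∀ a b, ContDiffOn ℝ ∞ (A a b) U) (a b : Fin 4) :
    ContDiffOn ℝ ∞ (dual2 g ε A a b) U := by
  have h1 := hg.contDiffOn_ginv
  unfold dual2 epsMixed
  fun_prop

theorem contDiffOn_xi (hg : IsChartMetric U g) {A : Fin 4 → Fin 4 → E4 → ℝ}
    {ε : Fin 4 → Fin 4 → Fin 4 → Fin 4 → E4 → ℝ}
    (hε : ∀ a b c d, ContDiffOn ℝ ∞ (ε a b c d) U)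
    (hA : ∀ a b, ContDiffOn ℝ ∞ (A a b) U) (a : Fin 4) :
    ContDiffOn ℝ ∞ (xi g ε A a) U := by
  have h1 := hg.contDiffOn_ginv
  have h2 := hg.contDiffOn_nabla2 (hg.contDiffOn_dual2 hε hA)
  unfold xi
  fun_prop

theorem christoffel_symm (hg : IsChartMetric U g) (hy : y ∈ U) (l m n : Fin 4) :
    christoffel g l m n y = christoffel g l n m y := by
  unfold christoffel
  congr 1
  refine Finset.sum_congr rfl fun s _ => ?_
  rw [pd_congr s hg.isOpen hy (hg.symm m n)]
  ring

theorem sum_mul_christoffel (hg : IsChartMetric U g) (hy : y ∈ U) (c m n : Fin 4) :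
    ∑ l, g c l y * christoffel g l m n y =
      (1 / 2) * (pd m (g c n) y + pd n (g c m) y - pd c (g m n) y) := by
  have h : ∀ l, g c l y * christoffel g l m n y = ∑ s, (g c l y * ginv g l s y) *
      ((1 / 2) * (pd m (g s n) y + pd n (g s m) y - pd s (g m n) y)) := by
    intro l
    rw [christoffel, Finset.mul_sum, Finset.mul_sum]
    exact Finset.sum_congr rfl fun s _ => by ring
  simp only [h]
  rw [Finset.sum_comm]
  simp only [← Finset.sum_mul, hg.sum_mul_ginv hy]
  simp

theorem pd_metric (hg : IsChartMetric U g) (hy : y ∈ U) (a b c : Fin 4) :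
    pd a (g b c) y = ∑ l, christoffel g l a b y * g l c y + ∑ l, christoffel g l a c y * g b l y := by
  have h1 := hg.sum_mul_christoffel hy c a b
  have h2 := hg.sum_mul_christoffel hy b a c
  have e1 : ∑ l, christoffel g l a b y * g l c y = ∑ l, g c l y * christoffel g l a b y :=
    Finset.sum_congr rfl fun l _ => by rw [hg.symm c l y hy, mul_comm]
  have e2 : ∑ l, christoffel g l a c y * g b l y = ∑ l, g b l y * christoffel g l a c y :=
    Finset.sum_congr rfl fun l _ => by rw [mul_comm]
  rw [e1, e2, h1, h2, pd_congr a hg.isOpen hy (hg.symm c b), pd_congr b hg.isOpen hy (hg.symm c a),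
    pd_congr c hg.isOpen hy (hg.symm a b)]
  ring

end IsChartMetric
end Spacetime

namespace Spacetime
variable {U : Set E4} {y : E4} {g : Fin 4 → Fin 4 → E4 → ℝ}

/-! ### Connection and curvature as matrices -/

/-- The matrix `(Γ_a)^l_b = Γ^l_{ab}`. -/
noncomputable def chMat (g : Fin 4 → Fin 4 → E4 → ℝ) (y : E4) (a : Fin 4) : Matrix (Fin 4) (Fin 4) ℝ :=
  Matrix.of fun l b => christoffel g l a b y

/-- The curvature matrix `(R_{ab})^l_m = R^l_{mab}`. -/
noncomputable def riemMat (g : Fin 4 → Fin 4 → E4 → ℝ) (y : E4) (a b : Fin 4) : Matrix (Fin 4) (Fin 4) ℝ :=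
  Matrix.of fun l m => riemann g l m a b y

/-- The matrix of components of a tensor of rank 2 at a point. -/
def matAt (A : Fin 4 → Fin 4 → E4 → ℝ) (y : E4) : Matrix (Fin 4) (Fin 4) ℝ :=
  Matrix.of fun a b => A a b y

/-- With the connection written as matrices, the product-rule computations below become identities
in a noncommutative ring. -/
theorem matAt_nabla2 (g A : Fin 4 → Fin 4 → E4 → ℝ) (y : E4) (b : Fin 4) :
    matAt (nabla2 g A b) y = matAt (fun c d => pd b (A c d)) y -
      (chMat g y b).transpose * matAt A y - matAt A y * chMat g y b := by
  ext c d
  simp only [matAt, chMat, nabla2, Matrix.sub_apply, Matrix.mul_apply, Matrix.transpose_apply,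
    Matrix.of_apply]
  congr 1
  exact Finset.sum_congr rfl fun l _ => mul_comm _ _

namespace IsChartMetric

theorem pd_matAt_metric (hg : IsChartMetric U g) (hy : y ∈ U) (a : Fin 4) :
    matAt (fun b c => pd a (g b c)) y =
      (chMat g y a).transpose * matAt g y + matAt g y * chMat g y a := by
  ext b c
  simp only [matAt, chMat, Matrix.add_apply, Matrix.mul_apply, Matrix.transpose_apply,
    Matrix.of_apply, hg.pd_metric hy]
  congr 1
  exact Finset.sum_congr rfl fun l _ => mul_comm _ _

theorem matAt_ginv_mul (hg : IsChartMetric U g) (hy : y ∈ U) :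
    matAt (ginv g) y * matAt g y = 1 :=
  Matrix.nonsing_inv_mul _ (hg.det_ne y hy).isUnit

theorem matAt_mul_ginv (hg : IsChartMetric U g) (hy : y ∈ U) :
    matAt g y * matAt (ginv g) y = 1 :=
  Matrix.mul_nonsing_inv _ (hg.det_ne y hy).isUnit

theorem pd_matAt_ginv (hg : IsChartMetric U g) (hy : y ∈ U) (a : Fin 4) :
    matAt (fun b c => pd a (ginv g b c)) y =
      -(chMat g y a * matAt (ginv g) y) - matAt (ginv g) y * (chMat g y a).transpose := by
  have hd1 := fun b c => differentiableAt_of_contDiffOn hg.isOpen (hg.contDiffOn_ginv b c) hy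
  have hd2 := fun b c => differentiableAt_of_contDiffOn hg.isOpen (hg.smooth b c) hy
  have h1 : matAt (fun b c => pd a (ginv g b c)) y * matAt g y +
      matAt (ginv g) y * matAt (fun b c => pd a (g b c)) y = 0 := by
    ext b c
    have h : pd a (fun x => ∑ l, ginv g b l x * g l c x) y = 0 := by
      rw [pd_congr a hg.isOpen hy (fun x hx => hg.sum_ginv_mul hx b c), pd_const]
    rw [pd_sum a (fun l => (hd1 b l).fun_mul (hd2 l c))] at h
    simp only [fun l => pd_mul a (hd1 b l) (hd2 l c), Finset.sum_add_distrib] at h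
    simpa [matAt, Matrix.mul_apply] using h
  rw [hg.pd_matAt_metric hy] at h1
  -- The derivative of `g⁻¹ g = 1`, multiplied on the right by `g⁻¹`, isolates the derivative of
  -- `g⁻¹`.
  have h2 := congrArg (· * matAt (ginv g) y) h1
  have e1 := hg.matAt_ginv_mul hy
  have e2 := hg.matAt_mul_ginv hy
  generalize matAt (fun b c => pd a (ginv g b c)) y = P at *
  generalize matAt (ginv g) y = I at *
  generalize matAt g y = G at *
  generalize chMat g y a = C at *
  have h3 : P * (G * I) + I * C.transpose * (G * I) + (I * G) * C * I = 0 := by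
    simpa [mul_add, add_mul, mul_assoc, add_assoc] using h2
  rw [e1, e2] at h3
  simp only [mul_one, one_mul] at h3
  rw [eq_sub_iff_add_eq, eq_neg_iff_add_eq_zero]
  exact h3

theorem riemMat_eq (y : E4) (a b : Fin 4) :
    riemMat g y a b = Matrix.of (fun l m => pd a (christoffel g l b m) y) -
      Matrix.of (fun l m => pd b (christoffel g l a m) y) +
      (chMat g y a * chMat g y b - chMat g y b * chMat g y a) := by
  ext l m
  simp [riemMat, riemann, chMat, Matrix.mul_apply]

/-- The Ricci identity for tensors of rank 2. -/
theorem ricci_identity (hg : IsChartMetric U g) (hy : y ∈ U) {A : Fin 4 → Fin 4 → E4 → ℝ}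
    (hA : ∀ a b, ContDiffOn ℝ ∞ (A a b) U) (a b c d : Fin 4) :
    (pd a (nabla2 g A b c d) y - ∑ l, christoffel g l a c y * nabla2 g A b l d y
        - ∑ l, christoffel g l a d y * nabla2 g A b c l y) -
      (pd b (nabla2 g A a c d) y - ∑ l, christoffel g l b c y * nabla2 g A a l d y
        - ∑ l, christoffel g l b d y * nabla2 g A a c l y) =
      -∑ l, riemann g l c a b y * A l d y - ∑ l, riemann g l d a b y * A c l y := by
  have hC := fun l m n => differentiableAt_of_contDiffOn hg.isOpen
    (hg.contDiffOn_christoffel l m n) hy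
  have hA1 := fun b c => differentiableAt_of_contDiffOn hg.isOpen (hA b c) hy
  have hA2 := fun a b c => differentiableAt_of_contDiffOn hg.isOpen
    (hg.contDiffOn_pd (hA b c) a) hy
  have hpN : ∀ a b, matAt (fun c d => pd a (nabla2 g A b c d)) y =
      matAt (fun c d => pd a (pd b (A c d))) y -
      (Matrix.of (fun l m => pd a (christoffel g l b m) y)).transpose * matAt A y -
      (chMat g y b).transpose * matAt (fun c d => pd a (A c d)) y -
      matAt (fun c d => pd a (A c d)) y * chMat g y b -
      matAt A y * Matrix.of (fun l m => pd a (christoffel g l b m) y) := by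
    intro a b; ext c d
    simp only [matAt, chMat, Matrix.sub_apply, Matrix.mul_apply, Matrix.transpose_apply,
      Matrix.of_apply]
    have e : nabla2 g A b c d = fun x => pd b (A c d) x - ∑ l, christoffel g l b c x * A l d x -
        ∑ l, christoffel g l b d x * A c l x := rfl
    rw [e, pd_sub a (by fun_prop) (by fun_prop), pd_sub a (by fun_prop) (by fun_prop),
      pd_sum a (by fun_prop), pd_sum a (by fun_prop)]
    simp only [fun l => pd_mul a (hC l b c) (hA1 l d), fun l => pd_mul a (hC l b d) (hA1 c l),
      Finset.sum_add_distrib]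
    have s1 : ∑ l, A c l y * pd a (christoffel g l b d) y =
        ∑ l, pd a (christoffel g l b d) y * A c l y :=
      Finset.sum_congr rfl fun l _ => mul_comm _ _
    have s2 : ∑ l, pd a (A c l) y * christoffel g l b d y =
        ∑ l, christoffel g l b d y * pd a (A c l) y :=
      Finset.sum_congr rfl fun l _ => mul_comm _ _
    rw [s1, s2]
    ring
  have hsymm : matAt (fun c d => pd a (pd b (A c d))) y =
      matAt (fun c d => pd b (pd a (A c d))) y := by
    ext c d; exact pd_comm hg.isOpen (hA c d) hy a b
  -- The correction `Γ^l_{ab} ∇_l A_{cd}` for the index of the inner derivative is symmetric in `a,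
  -- b`, so it is left out of both second derivatives.
  have key : (matAt (fun c d => pd a (nabla2 g A b c d)) y -
        (chMat g y a).transpose * matAt (nabla2 g A b) y - matAt (nabla2 g A b) y * chMat g y a) -
      (matAt (fun c d => pd b (nabla2 g A a c d)) y -
        (chMat g y b).transpose * matAt (nabla2 g A a) y - matAt (nabla2 g A a) y * chMat g y b) =
      -((riemMat g y a b).transpose * matAt A y) - matAt A y * riemMat g y a b := by
    rw [hpN, hpN, matAt_nabla2, matAt_nabla2, hsymm, riemMat_eq]
    simp only [Matrix.transpose_add, Matrix.transpose_sub, Matrix.transpose_mul]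
    noncomm_ring
  have := congrFun (congrFun key c) d
  simp only [matAt, chMat, riemMat, Matrix.sub_apply, Matrix.neg_apply, Matrix.mul_apply,
    Matrix.transpose_apply, Matrix.of_apply] at this
  have s : ∀ b d' (e : Fin 4), ∑ l, nabla2 g A b d' l y * christoffel g l e d y =
      ∑ l, christoffel g l e d y * nabla2 g A b d' l y :=
    fun _ _ _ => Finset.sum_congr rfl fun l _ => mul_comm _ _
  have s3 : ∑ l, A c l y * riemann g l d a b y = ∑ l, riemann g l d a b y * A c l y :=
    Finset.sum_congr rfl fun l _ => mul_comm _ _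
  rw [s, s, s3] at this
  exact this

theorem nabla2_metric (hg : IsChartMetric U g) (hy : y ∈ U) (a b c : Fin 4) :
    nabla2 g g a b c y = 0 := by
  rw [nabla2, hg.pd_metric hy]
  ring

/-! ### Symmetries of the Riemann tensor -/

theorem riemann_swap (y : E4) (l m a b : Fin 4) :
    riemann g l m b a y = -riemann g l m a b y := by
  simp only [riemann, Finset.sum_sub_distrib]
  ring

theorem riemann_cyclic (hg : IsChartMetric U g) (hy : y ∈ U) (l a b c : Fin 4) :
    riemann g l a b c y + riemann g l b c a y + riemann g l c a b y = 0 := by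
  have h := fun i l m n => pd_congr i hg.isOpen hy fun x hx => hg.christoffel_symm hx l m n
  simp only [riemann, Finset.sum_sub_distrib]
  rw [h b l c a, h a l c b, h c l b a]
  simp only [hg.christoffel_symm hy _ c a, hg.christoffel_symm hy _ c b,
    hg.christoffel_symm hy _ b a]
  ring

/-- The Riemann tensor with all indices down, `R_{lmab} = g_{lk} R^k_{mab}`. -/
noncomputable def _root_.Spacetime.riemannLow (g : Fin 4 → Fin 4 → E4 → ℝ) (l m a b : Fin 4) (y : E4) : ℝ :=
  ∑ k, g l k y * riemann g k m a b y

/-- The Ricci identity applied to the metric, for which `∇g = 0`. -/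
theorem riemannLow_swap_left (hg : IsChartMetric U g) (hy : y ∈ U) (l m a b : Fin 4) :
    riemannLow g m l a b y = -riemannLow g l m a b y := by
  have h := hg.ricci_identity hy hg.smooth a b l m
  have h0 : ∀ a b c d, pd a (nabla2 g g b c d) y = 0 := fun a b c d => by
    rw [pd_congr a hg.isOpen hy fun x hx => hg.nabla2_metric hx b c d, pd_const]
  simp only [h0, hg.nabla2_metric hy, mul_zero, Finset.sum_const_zero, sub_zero] at h
  unfold riemannLow
  have e : ∑ k, g m k y * riemann g k l a b y = ∑ k, riemann g k l a b y * g k m y :=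
    Finset.sum_congr rfl fun k _ => by rw [hg.symm m k y hy, mul_comm]
  have e' : ∑ k, g l k y * riemann g k m a b y = ∑ k, riemann g k m a b y * g l k y :=
    Finset.sum_congr rfl fun k _ => by rw [mul_comm]
  rw [e, e']
  linarith

theorem riemannLow_swap_right (y : E4) (l m a b : Fin 4) :
    riemannLow g l m b a y = -riemannLow g l m a b y := by
  simp [riemannLow, riemann_swap y _ m a b]

theorem riemannLow_cyclic (hg : IsChartMetric U g) (hy : y ∈ U) (l a b c : Fin 4) :
    riemannLow g l a b c y + riemannLow g l b c a y + riemannLow g l c a b y = 0 := by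
  simp only [riemannLow, ← Finset.sum_add_distrib, ← mul_add, hg.riemann_cyclic hy, mul_zero,
    Finset.sum_const_zero]

/-- The usual octahedron argument: the four cyclic identities are combined linearly with the
antisymmetry in each pair. -/
theorem riemannLow_pair (hg : IsChartMetric U g) (hy : y ∈ U) (l m a b : Fin 4) :
    riemannLow g a b l m y = riemannLow g l m a b y := by
  have s := hg.riemannLow_swap_left hy
  have r := riemannLow_swap_right (g := g) y
  linarith [hg.riemannLow_cyclic hy l m a b, hg.riemannLow_cyclic hy m l a b,
    hg.riemannLow_cyclic hy a l m b, hg.riemannLow_cyclic hy b l m a, s l m a b, s l a b m,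
    s l b m a, s m a l b, s m b a l, s a b l m, r l m a b, r m l a b, r a b l m, r l a b m,
    r l b a m, r l b m a, r m a b l, r m b l a, r a l m b, r a m b l, r b l m a, r b m a l]

theorem riemann_eq_sum (hg : IsChartMetric U g) (hy : y ∈ U) (l m a b : Fin 4) :
    riemann g l m a b y = ∑ k, ginv g l k y * riemannLow g k m a b y := by
  simp only [riemannLow, Finset.mul_sum, ← mul_assoc]
  rw [Finset.sum_comm]
  simp only [← Finset.sum_mul, hg.sum_ginv_mul hy]
  simp

end IsChartMetric
end Spacetime

namespace Spacetime

/-! ### Alternating symbols with four indices -/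

/-- Total antisymmetry of a function of four indices. -/
structure IsAlt4 (s : Fin 4 → Fin 4 → Fin 4 → Fin 4 → ℝ) : Prop where
  swap01 : ∀ a b c d, s b a c d = -s a b c d
  swap12 : ∀ a b c d, s a c b d = -s a b c d
  swap23 : ∀ a b c d, s a b d c = -s a b c d

namespace IsAlt4

variable {s t : Fin 4 → Fin 4 → Fin 4 → Fin 4 → ℝ}

theorem eq01 (h : IsAlt4 s) (a c d : Fin 4) : s a a c d = 0 := by linarith [h.swap01 a a c d]
theorem eq12 (h : IsAlt4 s) (a b d : Fin 4) : s a b b d = 0 := by linarith [h.swap12 a b b d]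
theorem eq23 (h : IsAlt4 s) (a b c : Fin 4) : s a b c c = 0 := by linarith [h.swap23 a b c c]
theorem eq02 (h : IsAlt4 s) (a b d : Fin 4) : s a b a d = 0 := by
  linarith [h.swap12 a a b d, h.eq01 a b d]
theorem eq13 (h : IsAlt4 s) (a b c : Fin 4) : s a b c b = 0 := by
  linarith [h.swap23 a b b c, h.eq12 a b c]
theorem eq03 (h : IsAlt4 s) (a b c : Fin 4) : s a b c a = 0 := by
  linarith [h.swap23 a b a c, h.eq02 a b c]

theorem rotate (h : IsAlt4 s) (a b c d : Fin 4) : s c d a b = s a b c d := by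
  linarith [h.swap12 c a d b, h.swap01 a c d b, h.swap23 a c b d, h.swap12 a b c d]

theorem eq_zero (h : IsAlt4 s) (h0 : s 0 1 2 3 = 0) (a b c d : Fin 4) : s a b c d = 0 := by
  have A : ∀ i j, (∀ c d, s i j c d = -s j i c d) := fun i j c d => h.swap01 j i c d
  have B : ∀ i j, (∀ c d, s c i j d = -s c j i d) := fun i j c d => h.swap12 c j i d
  have C : ∀ i j, (∀ c d, s c d i j = -s c d j i) := fun i j c d => h.swap23 c d j i
  fin_cases a <;> fin_cases b <;> fin_cases c <;> fin_cases d <;>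
    first
    | exact h.eq01 _ _ _ | exact h.eq12 _ _ _ | exact h.eq23 _ _ _ | exact h.eq02 _ _ _
    | exact h.eq13 _ _ _ | exact h.eq03 _ _ _
    | simp [A 1 0, A 2 0, A 3 0, A 2 1, A 3 1, A 3 2, B 2 0, B 3 0, B 2 1, B 3 1, B 3 2,
        C 3 0, C 3 1, C 3 2, h0]

/-- Alternating 4-forms in dimension 4 form a line. This reduces identities with four free indices
to a single component. -/
theorem ext (hs : IsAlt4 s) (ht : IsAlt4 t) (h0 : s 0 1 2 3 = t 0 1 2 3) (a b c d : Fin 4) :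
    s a b c d = t a b c d := by
  have h : IsAlt4 fun a b c d => s a b c d - t a b c d :=
    ⟨fun a b c d => by rw [hs.swap01, ht.swap01]; ring,
      fun a b c d => by rw [hs.swap12, ht.swap12]; ring,
      fun a b c d => by rw [hs.swap23, ht.swap23]; ring⟩
  exact sub_eq_zero.1 (h.eq_zero (sub_eq_zero.2 h0) a b c d)

theorem const_mul (hs : IsAlt4 s) (k : ℝ) : IsAlt4 fun a b c d => k * s a b c d :=
  ⟨fun a b c d => by rw [hs.swap01]; ring, fun a b c d => by rw [hs.swap12]; ring,
    fun a b c d => by rw [hs.swap23]; ring⟩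

/-- A linear map acts on alternating forms of top degree by its trace. -/
theorem sum_derivation (hs : IsAlt4 s) (A : Fin 4 → Fin 4 → ℝ) (a b c d : Fin 4) :
    (∑ l, A l a * s l b c d) + (∑ l, A l b * s a l c d) + (∑ l, A l c * s a b l d)
      + (∑ l, A l d * s a b c l) = (∑ l, A l l) * s a b c d := by
  refine IsAlt4.ext (s := fun a b c d => (∑ l, A l a * s l b c d) + (∑ l, A l b * s a l c d)
    + (∑ l, A l c * s a b l d) + (∑ l, A l d * s a b c l))
    (t := fun a b c d => (∑ l, A l l) * s a b c d) ⟨?_, ?_, ?_⟩ (hs.const_mul _) ?_ a b c d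
  · intro a b c d
    simp only [fun l => hs.swap01 l a c d, fun l => hs.swap01 b l c d, fun l => hs.swap01 a b l d,
      fun l => hs.swap01 a b c l, mul_neg, Finset.sum_neg_distrib]
    ring
  · intro a b c d
    simp only [fun l => hs.swap12 l b c d, fun l => hs.swap12 a l c d, fun l => hs.swap12 a b l d,
      fun l => hs.swap12 a b c l, mul_neg, Finset.sum_neg_distrib]
    ring
  · intro a b c d
    simp only [fun l => hs.swap23 l b c d, fun l => hs.swap23 a l c d, fun l => hs.swap23 a b l d,
      fun l => hs.swap23 a b c l, mul_neg, Finset.sum_neg_distrib]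
    ring
  -- In the component `0123` every off-diagonal entry of `A` meets a repeated index, so only the
  -- trace survives.
  · simp [Fin.sum_univ_four, hs.eq01, hs.eq12, hs.eq23, hs.eq02, hs.eq13, hs.eq03]
    ring

end IsAlt4

/-! ### Determinants of `g` with repeated rows and columns -/

/-- The `2 × 2` minor of `G` with rows `a, b` and columns `c, d`. -/
def minor2 (G : Fin 4 → Fin 4 → ℝ) (a b c d : Fin 4) : ℝ := G a c * G b d - G a d * G b c

/-- The `3 × 3` minor of `G` with rows `a, b, c` and columns `d, e, f`. -/
def minor3 (G : Fin 4 → Fin 4 → ℝ) (a b c d e f : Fin 4) : ℝ :=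
  G c f * minor2 G a b d e - G c e * minor2 G a b d f + G c d * minor2 G a b e f

/-- The `4 × 4` minor of `G` with rows `a, b, c, d` and columns `e, f, h, i`. -/
def minor4 (G : Fin 4 → Fin 4 → ℝ) (a b c d e f h i : Fin 4) : ℝ :=
  G d i * minor3 G a b c e f h - G d h * minor3 G a b c e f i + G d f * minor3 G a b c e h i
    - G d e * minor3 G a b c f h i

section
variable {s : Fin 4 → Fin 4 → Fin 4 → Fin 4 → ℝ} {G I : Fin 4 → Fin 4 → ℝ}

theorem isAlt4_minor4_left (e f h i : Fin 4) : IsAlt4 fun a b c d => minor4 G a b c d e f h i :=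
  ⟨fun a b c d => by simp only [minor4, minor3, minor2]; ring,
    fun a b c d => by simp only [minor4, minor3, minor2]; ring,
    fun a b c d => by simp only [minor4, minor3, minor2]; ring⟩

theorem isAlt4_minor4_right (a b c d : Fin 4) : IsAlt4 fun e f h i => minor4 G a b c d e f h i :=
  ⟨fun e f h i => by simp only [minor4, minor3, minor2]; ring,
    fun e f h i => by simp only [minor4, minor3, minor2]; ring,
    fun e f h i => by simp only [minor4, minor3, minor2]; ring⟩

theorem det_eq_minor4 (G : Fin 4 → Fin 4 → ℝ) :
    (Matrix.of fun a b => G a b).det = minor4 G 0 1 2 3 0 1 2 3 := by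
  simp [Matrix.det_succ_row_zero, Fin.sum_univ_succ, Fin.succAbove, minor4, minor3, minor2]
  ring

/-- Uniqueness of alternating 4-forms is applied to the second factor and then to the first. The
minus sign is the Lorentzian one from `hsq`. -/
theorem IsAlt4.mul_eq_minor4 (hs : IsAlt4 s)
    (hsq : s 0 1 2 3 ^ 2 = -(Matrix.of fun a b => G a b).det) (a b c d e f h i : Fin 4) :
    s a b c d * s e f h i = -minor4 G a b c d e f h i := by
  rw [det_eq_minor4] at hsq
  have h1 : ∀ e f h i, s 0 1 2 3 * s e f h i = -1 * minor4 G 0 1 2 3 e f h i := fun e f h i =>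
    IsAlt4.ext (hs.const_mul _) ((isAlt4_minor4_right 0 1 2 3).const_mul _) (by linarith) e f h i
  have h2 := IsAlt4.ext (hs.const_mul (s e f h i))
    ((isAlt4_minor4_left (G := G) e f h i).const_mul (-1)) (by linarith [h1 e f h i]) a b c d
  linarith

/-- `I` is a symmetric inverse of the symmetric matrix `G`. -/
structure IsInv (G I : Fin 4 → Fin 4 → ℝ) : Prop where
  symm : ∀ a b, G a b = G b a
  symm_inv : ∀ a b, I a b = I b a
  mul_inv : ∀ a b, ∑ l, G a l * I l b = if a = b then 1 else 0

namespace IsInv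

theorem inv_mul (h : IsInv G I) (a b : Fin 4) : ∑ l, I a l * G l b = if a = b then 1 else 0 := by
  rw [← Finset.sum_congr rfl fun l _ => (show G b l * I l a = I a l * G l b by
    rw [h.symm b l, h.symm_inv l a, mul_comm]), h.mul_inv]
  simp [eq_comm]

theorem sum_lower_raise (h : IsInv G I) (a : Fin 4) (v : Fin 4 → ℝ) :
    ∑ l, G a l * ∑ k, I l k * v k = v a := by
  simp only [Finset.mul_sum, ← mul_assoc]
  rw [Finset.sum_comm]
  simp [← Finset.sum_mul, h.mul_inv]

theorem sum_raise_lower (h : IsInv G I) (a : Fin 4) (v : Fin 4 → ℝ) :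
    ∑ l, I a l * ∑ k, G l k * v k = v a := by
  simp only [Finset.mul_sum, ← mul_assoc]
  rw [Finset.sum_comm]
  simp [← Finset.sum_mul, h.inv_mul]

theorem trace (h : IsInv G I) : ∑ d, ∑ i, I d i * G d i = 4 := by
  have : ∀ d, ∑ i, I d i * G d i = 1 := fun d => by
    rw [Finset.sum_congr rfl fun i _ => by rw [h.symm d i], h.inv_mul, if_pos rfl]
  simp [this]

theorem sum_sum (h : IsInv G I) (a b : Fin 4) : ∑ d, ∑ i, I d i * (G d a * G b i) = G b a := by
  have : ∀ d, ∑ i, I d i * (G d a * G b i) = (if b = d then 1 else 0) * G d a := fun d => by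
    rw [← h.mul_inv b d, Finset.sum_mul]
    exact Finset.sum_congr rfl fun i _ => by rw [h.symm_inv d i]; ring
  simp [this]

/-- In the Laplace expansion the diagonal term contributes the trace 4 and the mixed terms take away
3 copies of the minor. For the next contraction the count is `4 - 2 = 2`. -/
theorem sum_minor4 (h : IsInv G I) (a b c e f k : Fin 4) :
    ∑ d, ∑ i, I d i * minor4 G a b c d e f k i = minor3 G a b c e f k := by
  have e1 : ∀ d i, I d i * minor4 G a b c d e f k i =
      I d i * G d i * minor3 G a b c e f k
      - I d i * (G d k * G c i) * minor2 G a b e f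
      + I d i * (G d k * G b i) * minor2 G a c e f
      - I d i * (G d k * G a i) * minor2 G b c e f
      + I d i * (G d f * G c i) * minor2 G a b e k
      - I d i * (G d f * G b i) * minor2 G a c e k
      + I d i * (G d f * G a i) * minor2 G b c e k
      - I d i * (G d e * G c i) * minor2 G a b f k
      + I d i * (G d e * G b i) * minor2 G a c f k
      - I d i * (G d e * G a i) * minor2 G b c f k := fun d i => by
    simp only [minor4, minor3, minor2]; ring
  simp only [e1, Finset.sum_add_distrib, Finset.sum_sub_distrib, ← Finset.sum_mul, h.trace,
    h.sum_sum]
  simp only [minor3, minor2]; ring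

theorem sum_minor3 (h : IsInv G I) (a b d e : Fin 4) :
    ∑ c, ∑ i, I c i * minor3 G a b c d e i = 2 * minor2 G a b d e := by
  have e1 : ∀ c i, I c i * minor3 G a b c d e i =
      I c i * G c i * minor2 G a b d e
      - I c i * (G c e * G b i) * G a d + I c i * (G c e * G a i) * G b d
      + I c i * (G c d * G b i) * G a e - I c i * (G c d * G a i) * G b e := fun c i => by
    simp only [minor3, minor2]; ring
  simp only [e1, Finset.sum_add_distrib, Finset.sum_sub_distrib, ← Finset.sum_mul, h.trace,
    h.sum_sum]
  simp only [minor2]; ring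

end IsInv

/-- `ε_{ab}^{ρσ} ε_{ρσcd} = -2 (g_{ac} g_{bd} - g_{ad} g_{bc})`. -/
theorem IsAlt4.sum_mixed_mul (hs : IsAlt4 s)
    (hsq : s 0 1 2 3 ^ 2 = -(Matrix.of fun a b => G a b).det) (hI : IsInv G I)
    (a b c d : Fin 4) :
    ∑ r, ∑ q, (∑ k, ∑ t, s a b k t * I k r * I t q) * s r q c d = -2 * minor2 G a b c d := by
  have h1 : ∀ k r, ∑ t, ∑ q, I t q * (s a b k t * s c d r q) = -minor3 G a b k c d r := fun k r => by
    simp only [hs.mul_eq_minor4 hsq, mul_neg, Finset.sum_neg_distrib, hI.sum_minor4]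
  have h2 : ∑ k, ∑ r, I k r * ∑ t, ∑ q, I t q * (s a b k t * s c d r q)
      = -2 * minor2 G a b c d := by
    simp only [h1, mul_neg, Finset.sum_neg_distrib, hI.sum_minor3]; ring
  rw [← h2]
  simp only [Finset.sum_mul, Finset.mul_sum]
  rw [Finset.sum_congr rfl fun r _ => Finset.sum_comm, Finset.sum_comm]
  refine Finset.sum_congr rfl fun k _ => Finset.sum_congr rfl fun r _ => ?_
  rw [Finset.sum_comm]
  refine Finset.sum_congr rfl fun t _ => Finset.sum_congr rfl fun q _ => ?_
  rw [hs.rotate c d r q]; ring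

/-- The Hodge dual `½ s_{bc}^{rq} A_{rq}`, with indices raised by `I`. -/
noncomputable def hodge (s : Fin 4 → Fin 4 → Fin 4 → Fin 4 → ℝ) (I A : Fin 4 → Fin 4 → ℝ)
    (b c : Fin 4) : ℝ :=
  (1 / 2) * ∑ r, ∑ q, (∑ k, ∑ t, s b c k t * I k r * I t q) * A r q

/-- `A` with both indices raised by `I`. -/
def raise2 (I A : Fin 4 → Fin 4 → ℝ) (k t : Fin 4) : ℝ := ∑ l, ∑ m, I k l * I t m * A l m

theorem hodge_eq_sum_raise2 (s : Fin 4 → Fin 4 → Fin 4 → Fin 4 → ℝ) (I A : Fin 4 → Fin 4 → ℝ)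
    (b c : Fin 4) : hodge s I A b c = (1 / 2) * ∑ k, ∑ t, s b c k t * raise2 I A k t := by
  unfold hodge raise2
  congr 1
  simp only [Finset.mul_sum, Finset.sum_mul]
  rw [Finset.sum_congr rfl fun r _ => Finset.sum_comm, Finset.sum_comm]
  refine Finset.sum_congr rfl fun k _ => ?_
  rw [Finset.sum_congr rfl fun r _ => Finset.sum_comm, Finset.sum_comm]
  refine Finset.sum_congr rfl fun t _ => Finset.sum_congr rfl fun r _ =>
    Finset.sum_congr rfl fun q _ => by ring

end
end Spacetime

/-! ### The volume form is parallel, and the Hodge dual commutes with the covariant derivative. -/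

namespace Spacetime

/-- `sum_derivation` paired with a bivector `B`: an endomorphism acting on `B` is moved to the two
free indices of `s`, at the cost of its trace. It serves for the connection, for the curvature and
for elementary matrices. -/
theorem IsAlt4.sum_derivation_pair {s : Fin 4 → Fin 4 → Fin 4 → Fin 4 → ℝ} (hs : IsAlt4 s)
    (A B : Fin 4 → Fin 4 → ℝ) (b c : Fin 4) :
    ∑ k, ∑ t, s b c k t * ((∑ l, A k l * B l t) + ∑ l, A t l * B k l) =
      (∑ l, A l l) * (∑ k, ∑ t, s b c k t * B k t)
        - (∑ l, A l b * ∑ k, ∑ t, s l c k t * B k t)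
        - ∑ l, A l c * ∑ k, ∑ t, s b l k t * B k t := by
  have h1 : ∑ k, ∑ t, s b c k t * ∑ l, A k l * B l t =
      ∑ k, ∑ t, (∑ l, A l k * s b c l t) * B k t := by
    simp only [Finset.mul_sum, Finset.sum_mul]
    rw [Finset.sum_congr rfl fun k _ => Finset.sum_comm, Finset.sum_comm]
    exact Finset.sum_congr rfl fun l _ => by
      rw [Finset.sum_comm]
      exact Finset.sum_congr rfl fun t _ => Finset.sum_congr rfl fun k _ => by ring
  have h2 : ∑ k, ∑ t, s b c k t * ∑ l, A t l * B k l =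
      ∑ k, ∑ t, (∑ l, A l t * s b c k l) * B k t := by
    simp only [Finset.mul_sum, Finset.sum_mul]
    refine Finset.sum_congr rfl fun k _ => ?_
    rw [Finset.sum_comm]
    exact Finset.sum_congr rfl fun l _ => Finset.sum_congr rfl fun t _ => by ring
  have h3 : ∑ l, A l b * ∑ k, ∑ t, s l c k t * B k t =
      ∑ k, ∑ t, (∑ l, A l b * s l c k t) * B k t := by
    simp only [Finset.mul_sum, Finset.sum_mul]
    rw [Finset.sum_comm]
    refine Finset.sum_congr rfl fun k _ => ?_
    rw [Finset.sum_comm]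
    exact Finset.sum_congr rfl fun l _ => Finset.sum_congr rfl fun t _ => by ring
  have h4 : ∑ l, A l c * ∑ k, ∑ t, s b l k t * B k t =
      ∑ k, ∑ t, (∑ l, A l c * s b l k t) * B k t := by
    simp only [Finset.mul_sum, Finset.sum_mul]
    rw [Finset.sum_comm]
    refine Finset.sum_congr rfl fun k _ => ?_
    rw [Finset.sum_comm]
    exact Finset.sum_congr rfl fun l _ => Finset.sum_congr rfl fun t _ => by ring
  have h5 : (∑ l, A l l) * (∑ k, ∑ t, s b c k t * B k t) =
      ∑ k, ∑ t, ((∑ l, A l l) * s b c k t) * B k t := by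
    simp only [Finset.mul_sum, mul_assoc]
  simp only [mul_add, Finset.sum_add_distrib]
  rw [h1, h2, h3, h4, h5]
  simp only [← Finset.sum_sub_distrib, ← Finset.sum_add_distrib]
  refine Finset.sum_congr rfl fun k _ => Finset.sum_congr rfl fun t _ => ?_
  rw [← hs.sum_derivation A b c k t]
  ring

variable {U : Set E4} {y : E4} {g : Fin 4 → Fin 4 → E4 → ℝ}
  {ε : Fin 4 → Fin 4 → Fin 4 → Fin 4 → E4 → ℝ}

theorem IsChartMetric.isInv (hg : IsChartMetric U g) (hy : y ∈ U) :
    IsInv (fun a b => g a b y) (fun a b => ginv g a b y) where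
  symm a b := hg.symm a b y hy
  symm_inv a b := hg.ginv_symm hy a b
  mul_inv a b := hg.sum_mul_ginv hy a b

/-- The components `ε_{abcd}` of a volume form on the range `U` of a chart. -/
structure IsChartVolume (U : Set E4) (g : Fin 4 → Fin 4 → E4 → ℝ)
    (ε : Fin 4 → Fin 4 → Fin 4 → Fin 4 → E4 → ℝ) : Prop where
  smooth : ∀ a b c d, ContDiffOn ℝ ∞ (ε a b c d) U
  alt : ∀ y ∈ U, IsAlt4 fun a b c d => ε a b c d y
  sq : ∀ y ∈ U, ε 0 1 2 3 y ^ 2 = -(Matrix.of fun a b => g a b y).det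

/-- Jacobi's formula combined with metric compatibility, checked by expanding the determinant. -/
theorem IsChartMetric.pd_det (hg : IsChartMetric U g) (hy : y ∈ U) (e : Fin 4) :
    pd e (fun x => (Matrix.of fun a b => g a b x).det) y =
      2 * (∑ l, christoffel g l e l y) * (Matrix.of fun a b => g a b y).det := by
  have hd := fun b c => differentiableAt_of_contDiffOn hg.isOpen (hg.smooth b c) hy
  have hp := hg.pd_metric hy e
  simp only [fun x => det_eq_minor4 fun a b => g a b x, minor4, minor3, minor2]
  simp (disch := fun_prop) only [pd_add, pd_sub, pd_mul]
  simp only [hp, Fin.sum_univ_four]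
  ring

namespace IsChartVolume

/-- The volume form is parallel. -/
theorem pd_eq (hg : IsChartMetric U g) (hε : IsChartVolume U g ε) (hy : y ∈ U)
    (e a b c d : Fin 4) :
    pd e (ε a b c d) y = (∑ l, christoffel g l e l y) * ε a b c d y := by
  have hd := differentiableAt_of_contDiffOn hg.isOpen (hε.smooth 0 1 2 3) hy
  -- By `IsAlt4.sum_derivation` the trace `Γ^l_{el}` stands for the four connection terms of `∇ε`.
  -- Both sides alternate, so the component `0123` decides.
  refine IsAlt4.ext (s := fun a b c d => pd e (ε a b c d) y) ⟨?_, ?_, ?_⟩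
    ((hε.alt y hy).const_mul _) ?_ a b c d
  · intro a b c d
    rw [pd_congr e hg.isOpen hy fun x hx => (hε.alt x hx).swap01 a b c d, pd_neg]
  · intro a b c d
    rw [pd_congr e hg.isOpen hy fun x hx => (hε.alt x hx).swap12 a b c d, pd_neg]
  · intro a b c d
    rw [pd_congr e hg.isOpen hy fun x hx => (hε.alt x hx).swap23 a b c d, pd_neg]
  -- The relation `ε₀₁₂₃² = -det g` is differentiated and the nonzero factor `ε₀₁₂₃` cancelled.
  · have h1 : ∀ x ∈ U, ε 0 1 2 3 x * ε 0 1 2 3 x = -(Matrix.of fun a b => g a b x).det :=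
      fun x hx => by rw [← pow_two, hε.sq x hx]
    have h2 := pd_congr e hg.isOpen hy h1
    rw [pd_mul e hd hd, pd_neg, hg.pd_det hy] at h2
    have h3 := h1 y hy
    have h4 : ε 0 1 2 3 y ≠ 0 := fun h => hg.det_ne y hy (by rw [h] at h3; linarith)
    apply mul_left_cancel₀ h4
    linear_combination h2 / 2 - (∑ l, christoffel g l e l y) * h3

end IsChartVolume

theorem dual2_eq_sum_raiseBoth (g A : Fin 4 → Fin 4 → E4 → ℝ)
    (ε : Fin 4 → Fin 4 → Fin 4 → Fin 4 → E4 → ℝ) (b c : Fin 4) (y : E4) :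
    dual2 g ε A b c y = (1 / 2) * ∑ k, ∑ t, ε b c k t y * raiseBoth g A k t y :=
  hodge_eq_sum_raise2 (fun a b c d => ε a b c d y) (fun a b => ginv g a b y)
    (fun a b => A a b y) b c

theorem matAt_raiseBoth (hg : IsChartMetric U g) (hy : y ∈ U) (A : Fin 4 → Fin 4 → E4 → ℝ) :
    matAt (raiseBoth g A) y = matAt (ginv g) y * matAt A y * matAt (ginv g) y := by
  ext a b
  simp only [matAt, raiseBoth, Matrix.mul_apply, Matrix.of_apply, Finset.sum_mul]
  rw [Finset.sum_comm]
  exact Finset.sum_congr rfl fun k _ => Finset.sum_congr rfl fun l _ => by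
    rw [hg.ginv_symm hy k b]; ring

theorem contDiffOn_raiseBoth (hg : IsChartMetric U g) {A : Fin 4 → Fin 4 → E4 → ℝ}
    (hA : ∀ a b, ContDiffOn ℝ ∞ (A a b) U) (a b : Fin 4) :
    ContDiffOn ℝ ∞ (raiseBoth g A a b) U := by
  have h1 := hg.contDiffOn_ginv
  unfold raiseBoth
  fun_prop

/-- The inverse metric is parallel, so raising indices commutes with `∇`; the Christoffel terms left
are those of upper indices. -/
theorem pd_raiseBoth (hg : IsChartMetric U g) (hy : y ∈ U) {A : Fin 4 → Fin 4 → E4 → ℝ}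
    (hA : ∀ a b, ContDiffOn ℝ ∞ (A a b) U) (a b c : Fin 4) :
    pd a (raiseBoth g A b c) y = raiseBoth g (nabla2 g A a) b c y -
      (∑ l, christoffel g b a l y * raiseBoth g A l c y +
        ∑ l, christoffel g c a l y * raiseBoth g A b l y) := by
  have hI := fun b c => differentiableAt_of_contDiffOn hg.isOpen (hg.contDiffOn_ginv b c) hy
  have hA1 := fun b c => differentiableAt_of_contDiffOn hg.isOpen (hA b c) hy
  have h : matAt (fun b c => pd a (raiseBoth g A b c)) y =
      matAt (fun b c => pd a (ginv g b c)) y * matAt A y * matAt (ginv g) y +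
      matAt (ginv g) y * matAt (fun b c => pd a (A b c)) y * matAt (ginv g) y +
      matAt (ginv g) y * matAt A y * matAt (fun b c => pd a (ginv g b c)) y := by
    ext b c
    have e : raiseBoth g A b c = fun x => ∑ l, ∑ k, ginv g b l x * ginv g c k x * A l k x := rfl
    simp only [matAt, Matrix.mul_apply, Matrix.add_apply, Matrix.of_apply, Finset.sum_mul]
    rw [e, pd_sum a (by fun_prop)]
    simp (disch := fun_prop) only [pd_sum, pd_mul]
    rw [Finset.sum_comm]
    simp only [← Finset.sum_add_distrib]
    refine Finset.sum_congr rfl fun k _ => Finset.sum_congr rfl fun l _ => ?_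
    rw [hg.ginv_symm hy k c, pd_congr a hg.isOpen hy fun x hx => hg.ginv_symm hx k c]
    ring
  have key : matAt (fun b c => pd a (raiseBoth g A b c)) y = matAt (raiseBoth g (nabla2 g A a)) y -
      (chMat g y a * matAt (raiseBoth g A) y +
        matAt (raiseBoth g A) y * (chMat g y a).transpose) := by
    rw [h, matAt_raiseBoth hg hy, matAt_raiseBoth hg hy, matAt_nabla2, hg.pd_matAt_ginv hy]
    noncomm_ring
  have := congrFun (congrFun key b) c
  simp only [matAt, chMat, Matrix.sub_apply, Matrix.add_apply, Matrix.mul_apply,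
    Matrix.transpose_apply, Matrix.of_apply] at this
  rw [this]
  congr 2
  exact Finset.sum_congr rfl fun l _ => mul_comm _ _

/-- The Hodge dual commutes with the covariant derivative. -/
theorem nabla2_dual2 (hg : IsChartMetric U g) (hε : IsChartVolume U g ε) (hy : y ∈ U)
    {A : Fin 4 → Fin 4 → E4 → ℝ} (hA : ∀ a b, ContDiffOn ℝ ∞ (A a b) U) (a b c : Fin 4) :
    nabla2 g (dual2 g ε A) a b c y = dual2 g ε (nabla2 g A a) b c y := by
  have hB := fun b c => differentiableAt_of_contDiffOn hg.isOpen (contDiffOn_raiseBoth hg hA b c) hy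
  have he := fun a b c d => differentiableAt_of_contDiffOn hg.isOpen (hε.smooth a b c d) hy
  have e : dual2 g ε A b c = fun x => (1 / 2) * ∑ k, ∑ t, ε b c k t x * raiseBoth g A k t x := by
    funext x; exact dual2_eq_sum_raiseBoth g A ε b c x
  -- The trace term from differentiating `ε` and the connection terms of the raised `A` combine into
  -- the connection terms of the free indices `b, c`.
  have hp := (hε.alt y hy).sum_derivation_pair (fun l k => christoffel g l a k y)
    (fun k t => raiseBoth g A k t y) b c
  have hpd : pd a (dual2 g ε A b c) y = (1 / 2) * ∑ k, ∑ t,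
      ((∑ l, christoffel g l a l y) * (ε b c k t y * raiseBoth g A k t y) +
        ε b c k t y * raiseBoth g (nabla2 g A a) k t y -
        ε b c k t y * (∑ l, christoffel g k a l y * raiseBoth g A l t y +
        ∑ l, christoffel g t a l y * raiseBoth g A k l y)) := by
    rw [e, pd_const_mul a _ (by fun_prop), pd_sum a (by fun_prop)]
    congr 1
    refine Finset.sum_congr rfl fun k _ => ?_
    rw [pd_sum a (by fun_prop)]
    refine Finset.sum_congr rfl fun t _ => ?_
    rw [pd_mul a (he b c k t) (hB k t), hε.pd_eq hg hy, pd_raiseBoth hg hy hA]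
    ring
  simp only [Finset.sum_add_distrib, Finset.sum_sub_distrib, ← Finset.mul_sum] at hpd
  rw [nabla2, hpd]
  simp only [dual2_eq_sum_raiseBoth]
  have hh : ∀ u v : Fin 4 → ℝ, ∑ l, u l * (1 / 2 * v l) = 1 / 2 * ∑ l, u l * v l := fun u v => by
    rw [Finset.mul_sum]
    exact Finset.sum_congr rfl fun l _ => by ring
  simp only [hh]
  linear_combination -(1 / 2) * hp

end Spacetime

/-! ### First derivatives of a Killing–Yano tensor and the integrability condition of its dual. -/

namespace Spacetime

/-- Contraction with a nonzero volume form identifies vectors with 3-forms. It supplies the vector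
behind `∇Y`. -/
theorem IsAlt4.exists_eq_sum {s : Fin 4 → Fin 4 → Fin 4 → Fin 4 → ℝ} (hs : IsAlt4 s)
    (h0 : s 0 1 2 3 ≠ 0) {H : Fin 4 → Fin 4 → Fin 4 → ℝ}
    (h01 : ∀ a b c, H b a c = -H a b c) (h12 : ∀ a b c, H a c b = -H a b c) :
    ∃ θ : Fin 4 → ℝ, ∀ a b c, H a b c = ∑ l, s a b c l * θ l := by
  -- `T q` is, up to sign, the wedge product of `H` with the `q`-th coordinate covector, hence a
  -- multiple of `s`; the ratio is the component `θ q`.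
  let T : Fin 4 → Fin 4 → Fin 4 → Fin 4 → Fin 4 → ℝ := fun q a b c d =>
    (if q = d then 1 else 0) * H a b c - (if q = c then 1 else 0) * H a b d
      + (if q = b then 1 else 0) * H a c d - (if q = a then 1 else 0) * H b c d
  have hT : ∀ q, IsAlt4 (T q) := fun q =>
    ⟨fun a b c d => by simp only [T]; rw [h01 a b c, h01 a b d]; ring,
      fun a b c d => by simp only [T]; rw [h12 a b c, h01 b c d]; ring,
      fun a b c d => by simp only [T]; rw [h12 a c d, h12 b c d]; ring⟩
  refine ⟨fun q => T q 0 1 2 3 / s 0 1 2 3, fun a b c => ?_⟩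
  have h1 : ∀ q, s a b c q * (T q 0 1 2 3 / s 0 1 2 3) = T q a b c q := fun q => by
    rw [mul_comm]
    exact IsAlt4.ext (hs.const_mul _) (hT q) (by field_simp) a b c q
  simp only [h1]
  -- The contraction over `q` counts `4 - 3 = 1` copies of `H a b c`.
  simp only [T, Finset.sum_add_distrib, Finset.sum_sub_distrib, ite_mul, one_mul, zero_mul,
    Finset.sum_ite_eq', Finset.mem_univ, if_true, Finset.sum_const,
    Finset.card_univ, Fintype.card_fin, nsmul_eq_mul]
  rw [h12 a b c, h12 b a c, h01 a b c]
  norm_num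
  ring

variable {U : Set E4} {y : E4} {g Y : Fin 4 → Fin 4 → E4 → ℝ}
  {ε : Fin 4 → Fin 4 → Fin 4 → Fin 4 → E4 → ℝ}

/-- The components of a Killing–Yano tensor on the range `U` of a chart. -/
structure IsChartKillingYano (U : Set E4) (g Y : Fin 4 → Fin 4 → E4 → ℝ) : Prop where
  smooth : ∀ a b, ContDiffOn ℝ ∞ (Y a b) U
  anti : ∀ a b, ∀ y ∈ U, Y b a y = -Y a b y
  killing : ∀ a b c, ∀ y ∈ U, nabla2 g Y b a c y = -nabla2 g Y a b c y

theorem nabla2_anti (hg : IsChartMetric U g) (hy : y ∈ U)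
    (hY : ∀ a b, ∀ y ∈ U, Y b a y = -Y a b y) (a b c : Fin 4) :
    nabla2 g Y a c b y = -nabla2 g Y a b c y := by
  unfold nabla2
  rw [pd_congr a hg.isOpen hy (hY b c), pd_neg]
  simp only [fun l => hY b l y hy, fun l => hY l c y hy, mul_neg, Finset.sum_neg_distrib]
  ring

namespace IsChartKillingYano

theorem exists_nabla2_eq (hg : IsChartMetric U g) (hε : IsChartVolume U g ε)
    (hY : IsChartKillingYano U g Y) (hy : y ∈ U) :
    ∃ θ : Fin 4 → ℝ, ∀ a b c, nabla2 g Y a b c y = ∑ l, ε a b c l y * θ l := by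
  refine (hε.alt y hy).exists_eq_sum ?_ (fun a b c => hY.killing a b c y hy)
    (fun a b c => nabla2_anti hg hy hY.anti a b c)
  intro h
  have := hε.sq y hy
  rw [h] at this
  exact hg.det_ne y hy (by linarith)

/-- Dualizing `∇_a Y_{bc} = ε_{abcl} θ^l` and contracting `ε ε` gives `∇Y*` in terms of `θ`; its
divergence then identifies `θ` with `ξ`. The two halves share the witness `θ` and are proved
together. -/
theorem nabla2_eq_and_dual (hg : IsChartMetric U g) (hε : IsChartVolume U g ε)
    (hY : IsChartKillingYano U g Y) (hy : y ∈ U) :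
    (∀ a b c, nabla2 g Y a b c y = ∑ l, ε a b c l y * ∑ k, ginv g l k y * xi g ε Y k y) ∧
    ∀ a b c, nabla2 g (dual2 g ε Y) a b c y =
      g c a y * xi g ε Y b y - g b a y * xi g ε Y c y := by
  obtain ⟨θ, hθ⟩ := exists_nabla2_eq hg hε hY hy
  have hI := hg.isInv hy
  have hs := hε.alt y hy
  have h1 : ∀ a b c, nabla2 g (dual2 g ε Y) a b c y =
      g c a y * (∑ l, g b l y * θ l) - g b a y * ∑ l, g c l y * θ l := by
    intro a b c
    rw [nabla2_dual2 hg hε hy hY.smooth, dual2]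
    have e1 : ∑ r, ∑ q, epsMixed g ε b c r q y * nabla2 g Y a r q y =
        ∑ l, (∑ r, ∑ q, epsMixed g ε b c r q y * ε r q a l y) * θ l := by
      simp only [hθ, Finset.mul_sum, Finset.sum_mul]
      rw [Finset.sum_congr rfl fun r _ => Finset.sum_comm, Finset.sum_comm]
      refine Finset.sum_congr rfl fun l _ => Finset.sum_congr rfl fun r _ =>
        Finset.sum_congr rfl fun q _ => ?_
      rw [hs.swap12 r a q l, hs.swap01 a r q l]; ring
    have e2 : ∀ l, ∑ r, ∑ q, epsMixed g ε b c r q y * ε r q a l y =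
        -2 * (g b a y * g c l y - g b l y * g c a y) := fun l =>
      hs.sum_mixed_mul (hε.sq y hy) hI b c a l
    rw [e1]
    simp only [e2, Finset.mul_sum, ← Finset.sum_sub_distrib]
    exact Finset.sum_congr rfl fun l _ => by ring
  -- The divergence contributes `1 - 4 = -3` times the lowered `θ`, which the factor `-1/3` in `xi`
  -- normalizes.
  have h2 : ∀ c, xi g ε Y c y = ∑ l, g c l y * θ l := by
    intro c
    simp only [xi, h1]
    generalize hv : (fun c => ∑ l, g c l y * θ l) = v
    have hv' : ∀ c, ∑ l, g c l y * θ l = v c := fun c => congrFun hv c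
    simp only [hv', mul_sub, Finset.sum_sub_distrib]
    have e1 : ∑ l, ∑ k, ginv g l k y * (g l k y * v c) = 4 * v c := by
      simp only [← mul_assoc, ← Finset.sum_mul]
      rw [hI.trace]
    have e2 : ∑ l, ∑ k, ginv g l k y * (g c k y * v l) = v c := by
      have : ∀ l, ∑ k, ginv g l k y * (g c k y * v l) = (if c = l then 1 else 0) * v l := fun l => by
        rw [← hI.mul_inv c l, Finset.sum_mul]
        exact Finset.sum_congr rfl fun k _ => by rw [hI.symm_inv k l]; ring
      simp [this]
    rw [e1, e2]; ring
  refine ⟨fun a b c => ?_, fun a b c => by rw [h1, h2, h2]⟩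
  rw [hθ]
  refine Finset.sum_congr rfl fun l _ => ?_
  simp only [h2]
  rw [hI.sum_raise_lower l θ]

theorem nabla2_dual_eq (hg : IsChartMetric U g) (hε : IsChartVolume U g ε)
    (hY : IsChartKillingYano U g Y) (hy : y ∈ U) (a b c : Fin 4) :
    nabla2 g (dual2 g ε Y) a b c y = g c a y * xi g ε Y b y - g b a y * xi g ε Y c y :=
  (nabla2_eq_and_dual hg hε hY hy).2 a b c

/-- The integrability condition of the closed conformal Killing–Yano tensor `Y*`. -/
theorem integrability (hg : IsChartMetric U g) (hε : IsChartVolume U g ε)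
    (hY : IsChartKillingYano U g Y) (hy : y ∈ U) (a b c d : Fin 4) :
    ∑ l, riemann g l c a b y * dual2 g ε Y l d y + ∑ l, riemann g l d a b y * dual2 g ε Y c l y =
      g c b y * nabla1 g (xi g ε Y) a d y - g d b y * nabla1 g (xi g ε Y) a c y
        - g c a y * nabla1 g (xi g ε Y) b d y + g d a y * nabla1 g (xi g ε Y) b c y := by
  have hxi := fun a => differentiableAt_of_contDiffOn hg.isOpen (hg.contDiffOn_xi hε.smooth
    hY.smooth a) hy
  have hgd := fun a b => differentiableAt_of_contDiffOn hg.isOpen (hg.smooth a b) hy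
  have key := hg.ricci_identity hy (hg.contDiffOn_dual2 hε.smooth hY.smooth) a b c d
  -- The two terms with `Γ^l_{ab}` that remain are symmetric in `a, b` and cancel in the commutator.
  have hpd : ∀ a b c d, pd a (nabla2 g (dual2 g ε Y) b c d) y
      - ∑ l, christoffel g l a c y * nabla2 g (dual2 g ε Y) b l d y
      - ∑ l, christoffel g l a d y * nabla2 g (dual2 g ε Y) b c l y =
      g d b y * nabla1 g (xi g ε Y) a c y - g c b y * nabla1 g (xi g ε Y) a d y
      + (∑ l, christoffel g l a b y * g d l y) * xi g ε Y c y
      - (∑ l, christoffel g l a b y * g c l y) * xi g ε Y d y := by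
    intro a b c d
    rw [pd_congr a hg.isOpen hy fun x hx => nabla2_dual_eq hg hε hY hx b c d]
    rw [pd_sub a (by fun_prop) (by fun_prop), pd_mul a (hgd d b) (hxi c),
      pd_mul a (hgd c b) (hxi d), hg.pd_metric hy, hg.pd_metric hy]
    simp only [nabla2_dual_eq hg hε hY hy, nabla1]
    simp only [mul_sub, Finset.sum_sub_distrib, add_mul, Finset.sum_mul, Finset.mul_sum]
    simp only [mul_assoc, mul_left_comm, mul_comm]
    ring
  rw [hpd, hpd] at key
  simp only [hg.christoffel_symm hy _ b a] at key
  linarith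

end IsChartKillingYano
end Spacetime

/-! ### The scalar `𝒵`, its gradient and its Hessian. -/

namespace Spacetime

variable {U : Set E4} {y : E4} {g Y : Fin 4 → Fin 4 → E4 → ℝ}
  {ε : Fin 4 → Fin 4 → Fin 4 → Fin 4 → E4 → ℝ}

theorem contDiffOn_raiseFst (hg : IsChartMetric U g) {A : Fin 4 → Fin 4 → E4 → ℝ}
    (hA : ∀ a b, ContDiffOn ℝ ∞ (A a b) U) (a b : Fin 4) :
    ContDiffOn ℝ ∞ (raiseFst g A a b) U := by
  have h1 := hg.contDiffOn_ginv
  unfold raiseFst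
  fun_prop

theorem pd_raiseFst (hg : IsChartMetric U g) (hy : y ∈ U) {A : Fin 4 → Fin 4 → E4 → ℝ}
    (hA : ∀ a b, ContDiffOn ℝ ∞ (A a b) U) (a b c : Fin 4) :
    pd a (raiseFst g A b c) y = raiseFst g (nabla2 g A a) b c y -
      ∑ l, christoffel g b a l y * raiseFst g A l c y +
        ∑ l, christoffel g l a c y * raiseFst g A b l y := by
  have hI := fun b c => differentiableAt_of_contDiffOn hg.isOpen (hg.contDiffOn_ginv b c) hy
  have hA1 := fun b c => differentiableAt_of_contDiffOn hg.isOpen (hA b c) hy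
  have hr : ∀ A, matAt (raiseFst g A) y = matAt (ginv g) y * matAt A y := fun A => by
    ext a b; simp [matAt, raiseFst, Matrix.mul_apply]
  have h : matAt (fun b c => pd a (raiseFst g A b c)) y =
      matAt (fun b c => pd a (ginv g b c)) y * matAt A y +
      matAt (ginv g) y * matAt (fun b c => pd a (A b c)) y := by
    ext b c
    have e : raiseFst g A b c = fun x => ∑ l, ginv g b l x * A l c x := rfl
    simp only [matAt, Matrix.mul_apply, Matrix.add_apply, Matrix.of_apply]
    rw [e, pd_sum a (by fun_prop), ← Finset.sum_add_distrib]
    exact Finset.sum_congr rfl fun l _ => pd_mul a (hI b l) (hA1 l c)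
  have key : matAt (fun b c => pd a (raiseFst g A b c)) y = matAt (raiseFst g (nabla2 g A a)) y -
      chMat g y a * matAt (raiseFst g A) y + matAt (raiseFst g A) y * chMat g y a := by
    rw [h, hr, hr, matAt_nabla2, hg.pd_matAt_ginv hy]
    noncomm_ring
  have := congrFun (congrFun key b) c
  simp only [matAt, chMat, Matrix.sub_apply, Matrix.add_apply, Matrix.mul_apply,
    Matrix.of_apply] at this
  rw [this]
  congr 1
  exact Finset.sum_congr rfl fun l _ => mul_comm _ _

/-- Contraction of the Hodge dual of `A` with `B` is symmetric in `A` and `B`. -/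
theorem sum_dual2_mul_raiseBoth (hε : IsChartVolume U g ε) (hy : y ∈ U)
    (A B : Fin 4 → Fin 4 → E4 → ℝ) :
    ∑ a, ∑ b, dual2 g ε A a b y * raiseBoth g B a b y =
      ∑ a, ∑ b, dual2 g ε B a b y * raiseBoth g A a b y := by
  simp only [dual2_eq_sum_raiseBoth, Finset.mul_sum, Finset.sum_mul]
  calc _ = ∑ k, ∑ t, ∑ a, ∑ b, 1 / 2 * (ε a b k t y * raiseBoth g A k t y) * raiseBoth g B a b y := by
        rw [Finset.sum_congr rfl fun a _ => Finset.sum_comm, Finset.sum_comm]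
        refine Finset.sum_congr rfl fun k _ => ?_
        rw [Finset.sum_congr rfl fun a _ => Finset.sum_comm, Finset.sum_comm]
    _ = _ := by
        refine Finset.sum_congr rfl fun k _ => Finset.sum_congr rfl fun t _ =>
          Finset.sum_congr rfl fun a _ => Finset.sum_congr rfl fun b _ => ?_
        rw [show ε a b k t y = ε k t a b y from (hε.alt y hy).rotate k t a b]; ring

/-- The action on lower indices is the transpose of the action on upper ones; this removes the
Christoffel symbols from the derivative of a full contraction. -/
theorem sum_connection_pair (C A B : Fin 4 → Fin 4 → ℝ) :
    ∑ a, ∑ b, ((∑ l, C l a * A l b) + ∑ l, C l b * A a l) * B a b =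
      ∑ a, ∑ b, A a b * ((∑ l, C a l * B l b) + ∑ l, C b l * B a l) := by
  simp only [add_mul, mul_add, Finset.sum_add_distrib, Finset.sum_mul, Finset.mul_sum]
  congr 1
  · rw [Finset.sum_congr rfl fun a _ => Finset.sum_comm, Finset.sum_comm]
    refine Finset.sum_congr rfl fun l _ => ?_
    rw [Finset.sum_comm]
    exact Finset.sum_congr rfl fun b _ => Finset.sum_congr rfl fun a _ => by ring
  · refine Finset.sum_congr rfl fun a _ => ?_
    rw [Finset.sum_comm]
    exact Finset.sum_congr rfl fun l _ => Finset.sum_congr rfl fun b _ => by ring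

theorem contDiffOn_scalarZ (hg : IsChartMetric U g) (hε : IsChartVolume U g ε)
    {A : Fin 4 → Fin 4 → E4 → ℝ} (hA : ∀ a b, ContDiffOn ℝ ∞ (A a b) U) :
    ContDiffOn ℝ ∞ (scalarZ g ε A) U := by
  have h1 := hg.contDiffOn_dual2 hε.smooth hA
  have h2 := contDiffOn_raiseBoth hg hA
  unfold scalarZ
  fun_prop

theorem hess_symm (hg : IsChartMetric U g) (hy : y ∈ U) {f : E4 → ℝ} (hf : ContDiffOn ℝ ∞ f U)
    (a b : Fin 4) : hess g f a b y = hess g f b a y := by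
  simp only [hess, nabla1, pd_comm hg.isOpen hf hy a b, hg.christoffel_symm hy _ a b]

/-- `Y* · ∇Y = ∇Y* · Y`, because the pairing `A* · B` is symmetric and `*` commutes with `∇`. Two
equal terms turn the factor `1/4` into `1/2`. -/
theorem pd_scalarZ (hg : IsChartMetric U g) (hε : IsChartVolume U g ε)
    {A : Fin 4 → Fin 4 → E4 → ℝ} (hA : ∀ a b, ContDiffOn ℝ ∞ (A a b) U) (hy : y ∈ U) (c : Fin 4) :
    pd c (scalarZ g ε A) y =
      (1 / 2) * ∑ a, ∑ b, nabla2 g (dual2 g ε A) c a b y * raiseBoth g A a b y := by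
  have h1 := fun a b => differentiableAt_of_contDiffOn hg.isOpen
    (hg.contDiffOn_dual2 hε.smooth hA a b) hy
  have h2 := fun a b => differentiableAt_of_contDiffOn hg.isOpen (contDiffOn_raiseBoth hg hA a b) hy
  have e : scalarZ g ε A = fun x => (1 / 4) * ∑ a, ∑ b, dual2 g ε A a b x * raiseBoth g A a b x :=
    rfl
  have hpd : pd c (scalarZ g ε A) y = (1 / 4) * ∑ a, ∑ b,
      (nabla2 g (dual2 g ε A) c a b y * raiseBoth g A a b y +
       dual2 g ε A a b y * raiseBoth g (nabla2 g A c) a b y +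
       (((∑ l, christoffel g l c a y * dual2 g ε A l b y) +
          ∑ l, christoffel g l c b y * dual2 g ε A a l y) * raiseBoth g A a b y -
        dual2 g ε A a b y * ((∑ l, christoffel g a c l y * raiseBoth g A l b y) +
          ∑ l, christoffel g b c l y * raiseBoth g A a l y))) := by
    rw [e, pd_const_mul c _ (by fun_prop), pd_sum c (by fun_prop)]
    congr 1
    refine Finset.sum_congr rfl fun a _ => ?_
    rw [pd_sum c (by fun_prop)]
    refine Finset.sum_congr rfl fun b _ => ?_
    rw [pd_mul c (h1 a b) (h2 a b), pd_raiseBoth hg hy hA, nabla2]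
    ring
  have h3 := sum_connection_pair (fun l a => christoffel g l c a y)
    (fun a b => dual2 g ε A a b y) (fun a b => raiseBoth g A a b y)
  have h4 := sum_dual2_mul_raiseBoth hε hy A (nabla2 g A c)
  simp only [← nabla2_dual2 hg hε hy hA] at h4
  rw [hpd]
  simp only [Finset.sum_add_distrib, Finset.sum_sub_distrib]
  rw [h4, h3]
  ring

theorem sum_metric_mul_raiseBoth (hg : IsChartMetric U g) (hy : y ∈ U)
    (A : Fin 4 → Fin 4 → E4 → ℝ) (a b : Fin 4) :
    ∑ k, g a k y * raiseBoth g A k b y = ∑ l, ginv g b l y * A a l y := by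
  have h := (hg.isInv hy).sum_lower_raise a fun l => ∑ k, ginv g b k y * A l k y
  rw [← h]
  refine Finset.sum_congr rfl fun k _ => ?_
  simp only [raiseBoth, Finset.mul_sum, mul_assoc]

namespace IsChartKillingYano

/-- `∇_c 𝒵 = Y^b_c ξ_b`. -/
theorem pd_scalarZ_eq (hg : IsChartMetric U g) (hε : IsChartVolume U g ε)
    (hY : IsChartKillingYano U g Y) (hy : y ∈ U) (c : Fin 4) :
    pd c (scalarZ g ε Y) y = ∑ b, raiseFst g Y b c y * xi g ε Y b y := by
  rw [pd_scalarZ hg hε hY.smooth hy]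
  have e1 : ∀ b, ∑ a, g c a y * raiseBoth g Y a b y = -raiseFst g Y b c y := fun b => by
    rw [sum_metric_mul_raiseBoth hg hy, raiseFst, ← Finset.sum_neg_distrib]
    exact Finset.sum_congr rfl fun l _ => by rw [hY.anti l c y hy]; ring
  have e2 : ∀ a b, raiseBoth g Y a b y = -raiseBoth g Y b a y := fun a b => by
    simp only [raiseBoth, ← Finset.sum_neg_distrib]
    rw [Finset.sum_comm]
    exact Finset.sum_congr rfl fun l _ => Finset.sum_congr rfl fun k _ => by
      rw [hY.anti l k y hy]; ring
  have e3 : ∑ a, ∑ b, g a c y * xi g ε Y b y * raiseBoth g Y a b y =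
      -∑ b, raiseFst g Y b c y * xi g ε Y b y := by
    rw [Finset.sum_comm, ← Finset.sum_neg_distrib]
    refine Finset.sum_congr rfl fun b _ => ?_
    rw [← neg_mul, ← e1, Finset.sum_mul]
    exact Finset.sum_congr rfl fun a _ => by rw [hg.symm a c y hy]; ring
  have e4 : ∑ a, ∑ b, g b c y * xi g ε Y a y * raiseBoth g Y a b y =
      ∑ b, raiseFst g Y b c y * xi g ε Y b y := by
    refine Finset.sum_congr rfl fun a _ => ?_
    rw [← neg_neg (raiseFst g Y a c y), ← e1, ← Finset.sum_neg_distrib, Finset.sum_mul]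
    exact Finset.sum_congr rfl fun b _ => by rw [hg.symm b c y hy, e2 a b]; ring
  simp only [nabla2_dual_eq hg hε hY hy, sub_mul, Finset.sum_sub_distrib]
  rw [e3, e4]
  ring

/-- `∇_a ∇_b 𝒵 = Y^l_b ∇_a ξ_l`. -/
theorem hess_scalarZ (hg : IsChartMetric U g) (hε : IsChartVolume U g ε)
    (hY : IsChartKillingYano U g Y) (hy : y ∈ U) (a b : Fin 4) :
    hess g (scalarZ g ε Y) a b y = ∑ l, raiseFst g Y l b y * nabla1 g (xi g ε Y) a l y := by
  have hxi := fun a => differentiableAt_of_contDiffOn hg.isOpen (hg.contDiffOn_xi hε.smooth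
    hY.smooth a) hy
  have hr := fun a b => differentiableAt_of_contDiffOn hg.isOpen
    (contDiffOn_raiseFst hg hY.smooth a b) hy
  -- This is `ε_{albk} ξ^k ξ^l`, antisymmetric against symmetric. Hence only `∇ξ` survives in the
  -- Hessian.
  have h0 : ∑ l, raiseFst g (nabla2 g Y a) l b y * xi g ε Y l y = 0 := by
    generalize hv : (fun l => ∑ k, ginv g l k y * xi g ε Y k y) = v
    have hv' : ∀ l, ∑ k, ginv g l k y * xi g ε Y k y = v l := fun l => congrFun hv l
    have e1 : ∑ l, raiseFst g (nabla2 g Y a) l b y * xi g ε Y l y =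
        ∑ k, nabla2 g Y a k b y * v k := by
      simp only [raiseFst, ← hv', Finset.sum_mul, Finset.mul_sum]
      rw [Finset.sum_comm]
      exact Finset.sum_congr rfl fun k _ => Finset.sum_congr rfl fun l _ => by
        rw [hg.ginv_symm hy k l]; ring
    have e2 : ∑ k, nabla2 g Y a k b y * v k = ∑ k, ∑ l, ε a k b l y * v l * v k := by
      refine Finset.sum_congr rfl fun k _ => ?_
      rw [(nabla2_eq_and_dual hg hε hY hy).1 a k b, Finset.sum_mul]
      simp only [hv']
    have e3 : ∑ k, ∑ l, ε a k b l y * v l * v k = -∑ k, ∑ l, ε a k b l y * v l * v k := by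
      conv_lhs => rw [Finset.sum_comm]
      simp only [← Finset.sum_neg_distrib]
      refine Finset.sum_congr rfl fun k _ => Finset.sum_congr rfl fun l _ => ?_
      have hs := hε.alt y hy
      have : ε a l b k y = -ε a k b l y := by
        have h1 := hs.swap12 a b l k
        have h2 := hs.swap23 a b k l
        have h3 := hs.swap12 a k b l
        linarith
      rw [this]; ring
    rw [e1, e2]; linarith
  have e1 : pd a (pd b (scalarZ g ε Y)) y =
      ∑ l, (raiseFst g (nabla2 g Y a) l b y * xi g ε Y l y +
        raiseFst g Y l b y * nabla1 g (xi g ε Y) a l y) +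
      (∑ l, raiseFst g Y l b y * ∑ k, christoffel g k a l y * xi g ε Y k y -
        ∑ l, (∑ k, christoffel g l a k y * raiseFst g Y k b y) * xi g ε Y l y) +
      ∑ l, (∑ k, christoffel g k a b y * raiseFst g Y l k y) * xi g ε Y l y := by
    rw [pd_congr a hg.isOpen hy fun x hx => pd_scalarZ_eq hg hε hY hx b, pd_sum a (by fun_prop)]
    simp only [← Finset.sum_add_distrib, ← Finset.sum_sub_distrib]
    refine Finset.sum_congr rfl fun l _ => ?_
    rw [pd_mul a (hr l b) (hxi l), pd_raiseFst hg hy hY.smooth, nabla1]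
    ring
  have e2 : ∑ l, raiseFst g Y l b y * ∑ k, christoffel g k a l y * xi g ε Y k y =
      ∑ l, (∑ k, christoffel g l a k y * raiseFst g Y k b y) * xi g ε Y l y := by
    simp only [Finset.sum_mul, Finset.mul_sum]
    rw [Finset.sum_comm]
    exact Finset.sum_congr rfl fun k _ => Finset.sum_congr rfl fun l _ => by ring
  have e3 : ∑ l, (∑ k, christoffel g k a b y * raiseFst g Y l k y) * xi g ε Y l y =
      ∑ l, christoffel g l a b y * pd l (scalarZ g ε Y) y := by
    simp only [pd_scalarZ_eq hg hε hY hy, Finset.sum_mul, Finset.mul_sum]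
    rw [Finset.sum_comm]
    exact Finset.sum_congr rfl fun k _ => Finset.sum_congr rfl fun l _ => by ring
  rw [hess, nabla1, e1, e2, e3, Finset.sum_add_distrib, h0]
  ring

end IsChartKillingYano
end Spacetime

namespace Spacetime

section
variable {s : Fin 4 → Fin 4 → Fin 4 → Fin 4 → ℝ} {G I : Fin 4 → Fin 4 → ℝ}

/-! ### Algebra of the Hodge dual -/

theorem raise2_anti {A : Fin 4 → Fin 4 → ℝ} (hA : ∀ a b, A b a = -A a b) (a b : Fin 4) :
    raise2 I A b a = -raise2 I A a b := by
  simp only [raise2, ← Finset.sum_neg_distrib]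
  rw [Finset.sum_comm]
  exact Finset.sum_congr rfl fun l _ => Finset.sum_congr rfl fun m _ => by rw [hA l m]; ring

theorem hodge_anti (hs : IsAlt4 s) (A : Fin 4 → Fin 4 → ℝ) (a b : Fin 4) :
    hodge s I A b a = -hodge s I A a b := by
  simp only [hodge_eq_sum_raise2, fun k t => hs.swap01 a b k t, neg_mul, Finset.sum_neg_distrib,
    mul_neg]

theorem hodge_add (A B : Fin 4 → Fin 4 → ℝ) (a b : Fin 4) :
    hodge s I (fun c d => A c d + B c d) a b = hodge s I A a b + hodge s I B a b := by
  simp only [hodge, mul_add, Finset.sum_add_distrib]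

theorem hodge_sum_mul (A : Fin 4 → Fin 4 → Fin 4 → ℝ) (v : Fin 4 → ℝ) (a b : Fin 4) :
    hodge s I (fun c d => ∑ l, A l c d * v l) a b = ∑ l, hodge s I (A l) a b * v l := by
  simp only [hodge, Finset.mul_sum, Finset.sum_mul]
  rw [Finset.sum_congr rfl fun r _ => Finset.sum_comm, Finset.sum_comm]
  refine Finset.sum_congr rfl fun l _ => Finset.sum_congr rfl fun r _ =>
    Finset.sum_congr rfl fun q _ => ?_
  refine Finset.sum_congr rfl fun k _ => Finset.sum_congr rfl fun t _ => by ring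

theorem hodge_symbol (hs : IsAlt4 s) (hsq : s 0 1 2 3 ^ 2 = -(Matrix.of fun a b => G a b).det)
    (hI : IsInv G I) (a b c d : Fin 4) :
    hodge s I (fun r q => s r q c d) a b = -minor2 G a b c d := by
  rw [hodge, hs.sum_mixed_mul hsq hI]; ring

theorem IsInv.sum_minor2_raise2 (hI : IsInv G I) (A : Fin 4 → Fin 4 → ℝ) (b c : Fin 4) :
    ∑ k, ∑ t, minor2 G b c k t * raise2 I A k t = A b c - A c b := by
  have h : ∀ b c, ∑ k, ∑ t, G b k * G c t * raise2 I A k t = A b c := fun b c => by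
    have e : ∀ k, ∑ t, G c t * raise2 I A k t = ∑ l, I k l * A l c := fun k => by
      rw [← hI.sum_lower_raise c fun t => ∑ l, I k l * A l t]
      refine Finset.sum_congr rfl fun t _ => ?_
      simp only [raise2, Finset.mul_sum]
      rw [Finset.sum_comm]
      exact Finset.sum_congr rfl fun l _ => Finset.sum_congr rfl fun m _ => by ring
    simp only [mul_assoc, ← Finset.mul_sum, e]
    exact hI.sum_lower_raise b fun l => A l c
  have h' : ∑ k, ∑ t, G b t * G c k * raise2 I A k t = A c b := by
    rw [← h c b]
    exact Finset.sum_congr rfl fun k _ => Finset.sum_congr rfl fun t _ => by ring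
  simp only [minor2, sub_mul, Finset.sum_sub_distrib, h, h']

/-- The sign `-1` comes from the Lorentzian relation `hsq`; the factors `1/2` offset the two equal
halves of the minor. -/
theorem hodge_hodge (hs : IsAlt4 s) (hsq : s 0 1 2 3 ^ 2 = -(Matrix.of fun a b => G a b).det)
    (hI : IsInv G I) {A : Fin 4 → Fin 4 → ℝ} (hA : ∀ a b, A b a = -A a b) (b c : Fin 4) :
    hodge s I (hodge s I A) b c = -A b c := by
  have e : hodge s I A = fun r q => ∑ k, (∑ t, s r q k t * raise2 I A k t) * (1 / 2) := by
    funext r q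
    rw [hodge_eq_sum_raise2, Finset.mul_sum]
    exact Finset.sum_congr rfl fun k _ => mul_comm _ _
  rw [e, hodge_sum_mul]
  simp only [hodge_sum_mul, hodge_symbol hs hsq hI, neg_mul, Finset.sum_neg_distrib]
  rw [← Finset.sum_mul, hI.sum_minor2_raise2, hA b c]
  ring

/-- The action of an endomorphism `F` on a bilinear form `A`. -/
def deriv2 (F A : Fin 4 → Fin 4 → ℝ) (c d : Fin 4) : ℝ :=
  ∑ l, F l c * A l d + ∑ l, F l d * A c l

/-- The hypothesis `hF` says that `F` is skew for the metric, so raising indices turns its action on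
forms into minus its action on bivectors. -/
theorem raise2_deriv2 {F : Fin 4 → Fin 4 → ℝ} (hsymm : ∀ a b, I a b = I b a)
    (hF : ∀ a b, ∑ l, F a l * I l b = -∑ l, F b l * I l a) (A : Fin 4 → Fin 4 → ℝ) (k t : Fin 4) :
    raise2 I (deriv2 F A) k t =
      -((∑ l, F k l * raise2 I A l t) + ∑ l, F t l * raise2 I A k l) := by
  have hr : ∀ A, Matrix.of (raise2 I A) = Matrix.of I * Matrix.of A * Matrix.of I := fun A => by
    ext a b
    simp only [raise2, Matrix.mul_apply, Matrix.of_apply, Finset.sum_mul]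
    rw [Finset.sum_comm]
    exact Finset.sum_congr rfl fun m _ => Finset.sum_congr rfl fun l _ => by
      rw [hsymm m b]; ring
  have hd : Matrix.of (deriv2 F A) =
      (Matrix.of F).transpose * Matrix.of A + Matrix.of A * Matrix.of F := by
    ext a b
    simp only [deriv2, Matrix.add_apply, Matrix.mul_apply, Matrix.transpose_apply, Matrix.of_apply]
    congr 1
    exact Finset.sum_congr rfl fun l _ => mul_comm _ _
  have hf : Matrix.of I * (Matrix.of F).transpose = -(Matrix.of F * Matrix.of I) := by
    ext a b
    simp only [Matrix.neg_apply, Matrix.mul_apply, Matrix.transpose_apply, Matrix.of_apply]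
    rw [hF a b, neg_neg]
    exact Finset.sum_congr rfl fun l _ => by rw [hsymm l a]; ring
  have hf' : Matrix.of F * Matrix.of I = -(Matrix.of I * (Matrix.of F).transpose) := by
    rw [hf, neg_neg]
  have key : Matrix.of (raise2 I (deriv2 F A)) =
      -(Matrix.of F * Matrix.of (raise2 I A) +
        Matrix.of (raise2 I A) * (Matrix.of F).transpose) := by
    rw [hr, hr, hd]
    calc _ = (Matrix.of I * (Matrix.of F).transpose) * Matrix.of A * Matrix.of I
          + Matrix.of I * Matrix.of A * (Matrix.of F * Matrix.of I) := by noncomm_ring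
      _ = -((Matrix.of F * Matrix.of I) * Matrix.of A * Matrix.of I
          + Matrix.of I * Matrix.of A * (Matrix.of I * (Matrix.of F).transpose)) := by
        rw [hf']; noncomm_ring
      _ = _ := by noncomm_ring
  have := congrFun (congrFun key k) t
  simp only [Matrix.neg_apply, Matrix.add_apply, Matrix.mul_apply, Matrix.transpose_apply,
    Matrix.of_apply] at this
  rw [this]
  congr 2
  exact Finset.sum_congr rfl fun l _ => mul_comm _ _

/-- The Hodge dual commutes with the action of antisymmetric endomorphisms. -/
theorem hodge_deriv2 (hs : IsAlt4 s) {F : Fin 4 → Fin 4 → ℝ} (hsymm : ∀ a b, I a b = I b a)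
    (hF : ∀ a b, ∑ l, F a l * I l b = -∑ l, F b l * I l a) (htr : ∑ l, F l l = 0)
    (A : Fin 4 → Fin 4 → ℝ) (b c : Fin 4) :
    hodge s I (deriv2 F A) b c = deriv2 F (hodge s I A) b c := by
  have h := hs.sum_derivation_pair F (raise2 I A) b c
  have hh : ∀ u v : Fin 4 → ℝ, ∑ l, u l * (1 / 2 * v l) = 1 / 2 * ∑ l, u l * v l := fun u v => by
    rw [Finset.mul_sum]
    exact Finset.sum_congr rfl fun l _ => by ring
  simp only [deriv2, hodge_eq_sum_raise2 s I, hh]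
  simp only [raise2_deriv2 hsymm hF, mul_neg, Finset.sum_neg_distrib]
  rw [htr] at h
  linarith

/-- `(*A)_{kt} A^{lt} = ¼ (*A)_{ab} A^{ab} δ^l_k`. -/
theorem sum_hodge_mul_raise2 (hs : IsAlt4 s) {A : Fin 4 → Fin 4 → ℝ}
    (hA : ∀ a b, A b a = -A a b) (k l : Fin 4) :
    ∑ t, hodge s I A k t * raise2 I A l t =
      if k = l then (1 / 4) * ∑ a, ∑ b, hodge s I A a b * raise2 I A a b else 0 := by
  generalize hB : raise2 I A = B
  have hBa : ∀ a b, B b a = -B a b := fun a b => by rw [← hB]; exact raise2_anti hA a b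
  have hh : ∀ b c, ∑ k, ∑ t, s b c k t * B k t = 2 * hodge s I A b c := fun b c => by
    rw [hodge_eq_sum_raise2, hB]; ring
  have ha := hodge_anti (I := I) hs A
  generalize hodge s I A = H at *
  -- Pairing `sum_derivation_pair` for an elementary matrix with `B` gives `4X = 2δ(H·B) - 4X`,
  -- where `X` is the sum sought.
  let F : Fin 4 → Fin 4 → ℝ := fun i j => (if i = k then 1 else 0) * (if j = l then 1 else 0)
  have h1 : ∑ b, ∑ c, B b c * ∑ i, ∑ t, s b c i t * ((∑ j, F i j * B j t) + ∑ j, F t j * B i j) =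
      ∑ b, ∑ c, B b c * ((∑ j, F j j) * (2 * H b c) - ∑ j, F j b * (2 * H j c)
        - ∑ j, F j c * (2 * H b j)) := by
    simp only [hs.sum_derivation_pair F B, hh]
  have h2 : ∀ X : Fin 4 → Fin 4 → ℝ, ∑ b, ∑ c, B b c * ∑ i, ∑ t, s b c i t * X i t =
      ∑ i, ∑ t, 2 * H i t * X i t := fun X => by
    simp only [← hh, Finset.mul_sum, Finset.sum_mul]
    rw [Finset.sum_congr rfl fun b _ => Finset.sum_comm, Finset.sum_comm]
    refine Finset.sum_congr rfl fun i _ => ?_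
    rw [Finset.sum_congr rfl fun b _ => Finset.sum_comm, Finset.sum_comm]
    refine Finset.sum_congr rfl fun t _ => Finset.sum_congr rfl fun b _ =>
      Finset.sum_congr rfl fun c _ => ?_
    rw [← hs.rotate b c i t]; ring
  have e1 : ∑ i, ∑ t, 2 * H i t * ((∑ j, F i j * B j t) + ∑ j, F t j * B i j) =
      4 * ∑ t, H k t * B l t := by
    have e : ∑ i, H i k * B i l = ∑ t, H k t * B l t :=
      Finset.sum_congr rfl fun i _ => by rw [ha k i, hBa l i]; ring
    simp [F, mul_add, Finset.sum_add_distrib, mul_assoc, ← Finset.mul_sum, e]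
    ring
  have e2 : ∑ b, ∑ c, B b c * ((∑ j, F j j) * (2 * H b c) - ∑ j, F j b * (2 * H j c)
        - ∑ j, F j c * (2 * H b j)) = (if k = l then 2 * ∑ a, ∑ b, H a b * B a b else 0)
        - 4 * ∑ t, H k t * B l t := by
    have e : ∑ b, B b l * H b k = ∑ t, H k t * B l t :=
      Finset.sum_congr rfl fun i _ => by rw [ha k i, hBa l i]; ring
    have e' : ∑ b, B l b * H k b = ∑ t, H k t * B l t :=
      Finset.sum_congr rfl fun i _ => mul_comm _ _
    have e'' : ∑ a, ∑ b, B a b * H a b = ∑ a, ∑ b, H a b * B a b :=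
      Finset.sum_congr rfl fun i _ => Finset.sum_congr rfl fun j _ => mul_comm _ _
    have eF : ∑ j, F j j = if k = l then 1 else 0 := by simp [F, eq_comm]
    simp only [eF, mul_sub, Finset.sum_sub_distrib]
    by_cases hkl : k = l
    · simp [F, hkl, mul_left_comm _ (2 : ℝ), ← Finset.mul_sum] at e e' e'' ⊢
      rw [e, e', e'']; ring
    · simp [F, hkl, mul_left_comm _ (2 : ℝ), ← Finset.mul_sum] at e e' e'' ⊢
      rw [e, e']; ring
  rw [h2, e1, e2] at h1
  split_ifs at h1 ⊢ <;> linarith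

end
end Spacetime

/-! ### Pointwise algebra: traces and dualization of the integrability condition. -/

namespace Spacetime

theorem sum_sum_eq_zero {A B : Fin 4 → Fin 4 → ℝ} (hA : ∀ a b, A b a = A a b)
    (hB : ∀ a b, B b a = -B a b) : ∑ a, ∑ b, A a b * B a b = 0 := by
  have h : ∑ a, ∑ b, A a b * B a b = -∑ a, ∑ b, A a b * B a b := by
    conv_lhs => rw [Finset.sum_comm]
    simp only [← Finset.sum_neg_distrib]
    exact Finset.sum_congr rfl fun a _ => Finset.sum_congr rfl fun b _ => by rw [hA a b, hB a b]; ring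
  linarith

/-- The values at one point of the tensors attached to a Killing–Yano tensor `Y`: the metric `G`
with inverse `I`, the volume form `s`, the dual `h` of `Y`, the Riemann tensors `R` and (with all
indices down) `Rl`, and `D a b = ∇_a ξ_b`. The integrability condition is that of `h`. -/
structure IsKillingYanoJet (G I : Fin 4 → Fin 4 → ℝ) (s : Fin 4 → Fin 4 → Fin 4 → Fin 4 → ℝ)
    (Y h D : Fin 4 → Fin 4 → ℝ) (Rl R : Fin 4 → Fin 4 → Fin 4 → Fin 4 → ℝ) : Prop where
  inv : IsInv G I
  alt : IsAlt4 s
  sq : s 0 1 2 3 ^ 2 = -(Matrix.of fun a b => G a b).det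
  anti : ∀ a b, Y b a = -Y a b
  dual : h = hodge s I Y
  left : ∀ l m a b, Rl m l a b = -Rl l m a b
  right : ∀ l m a b, Rl l m b a = -Rl l m a b
  cyclic : ∀ l a b c, Rl l a b c + Rl l b c a + Rl l c a b = 0
  pair : ∀ l m a b, Rl a b l m = Rl l m a b
  raise : ∀ l m a b, R l m a b = ∑ k, I l k * Rl k m a b
  integrable : ∀ a b c d, deriv2 (fun l m => R l m a b) h c d =
    G c b * D a d - G d b * D a c - G c a * D b d + G d a * D b c

namespace IsKillingYanoJet

variable {G I Y h D : Fin 4 → Fin 4 → ℝ} {s Rl R : Fin 4 → Fin 4 → Fin 4 → Fin 4 → ℝ}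

theorem dual_anti (J : IsKillingYanoJet G I s Y h D Rl R) (a b : Fin 4) : h b a = -h a b := by
  rw [J.dual]; exact hodge_anti J.alt _ a b

theorem sum_inv_mul_riemann (J : IsKillingYanoJet G I s Y h D Rl R) (k a : Fin 4) :
    ∑ c, ∑ b, I c b * Rl k c a b = ∑ l, R l k l a := by
  rw [Finset.sum_comm]
  refine Finset.sum_congr rfl fun b _ => ?_
  rw [J.raise]
  exact Finset.sum_congr rfl fun c _ => by
    rw [J.left c k, J.right c k b a, J.inv.symm_inv c b]; ring

theorem ricci_symm (J : IsKillingYanoJet G I s Y h D Rl R) (a b : Fin 4) :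
    ∑ l, R l b l a = ∑ l, R l a l b := by
  simp only [J.raise]
  rw [Finset.sum_comm]
  exact Finset.sum_congr rfl fun l _ => Finset.sum_congr rfl fun k _ => by
    rw [J.pair k a l b, J.inv.symm_inv k l]

/-- The first trace of the integrability condition. -/
theorem trace_integrable (J : IsKillingYanoJet G I s Y h D Rl R) (a d : Fin 4) :
    (∑ k, (∑ l, R l k l a) * ∑ m, I k m * h m d) + ∑ k, ∑ b, Rl k d a b * raise2 I h b k =
      2 * D a d + G d a * ∑ b, ∑ c, I b c * D b c := by
  have h1 : ∑ c, ∑ b, I c b * deriv2 (fun l m => R l m a b) h c d =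
      2 * D a d + G d a * ∑ b, ∑ c, I b c * D b c := by
    simp only [J.integrable]
    have e1 : ∑ c, ∑ b, I c b * (G c b * D a d) = 4 * D a d := by
      simp only [← mul_assoc, ← Finset.sum_mul]
      rw [J.inv.trace]
    have e2 : ∑ c, ∑ b, I c b * (G d b * D a c) = D a d := by
      rw [← J.inv.sum_lower_raise d (D a), Finset.sum_comm]
      exact Finset.sum_congr rfl fun b _ => by
        rw [Finset.mul_sum]
        exact Finset.sum_congr rfl fun c _ => by rw [J.inv.symm_inv c b]; ring
    have e3 : ∑ c, ∑ b, I c b * (G c a * D b d) = D a d := by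
      rw [← J.inv.sum_lower_raise a fun b => D b d]
      exact Finset.sum_congr rfl fun b _ => by
        rw [Finset.mul_sum]
        exact Finset.sum_congr rfl fun c _ => by rw [J.inv.symm a b]; ring
    have e4 : ∑ c, ∑ b, I c b * (G d a * D b c) = G d a * ∑ b, ∑ c, I b c * D b c := by
      rw [Finset.sum_comm, Finset.mul_sum]
      exact Finset.sum_congr rfl fun b _ => by
        rw [Finset.mul_sum]
        exact Finset.sum_congr rfl fun c _ => by rw [J.inv.symm_inv c b]; ring
    simp only [mul_sub, mul_add, Finset.sum_sub_distrib, Finset.sum_add_distrib, e1, e2, e3, e4]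
    ring
  rw [← h1]
  simp only [deriv2, mul_add, Finset.sum_add_distrib]
  congr 1
  · have e : ∀ l, ∑ k, I l k * (∑ m, R m k m a) = ∑ c, ∑ b, I c b * R l c a b := fun l => by
      simp only [← J.sum_inv_mul_riemann]
      simp only [J.raise, Finset.mul_sum]
      rw [Finset.sum_comm]
      refine Finset.sum_congr rfl fun c _ => ?_
      rw [Finset.sum_comm]
      exact Finset.sum_congr rfl fun b _ => Finset.sum_congr rfl fun k _ => by ring
    have e' : ∀ r : Fin 4 → ℝ, ∑ k, r k * ∑ m, I k m * h m d = ∑ l, (∑ k, I l k * r k) * h l d :=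
      fun r => by
        simp only [Finset.sum_mul, Finset.mul_sum]
        rw [Finset.sum_comm]
        exact Finset.sum_congr rfl fun l _ => Finset.sum_congr rfl fun k _ => by
          rw [J.inv.symm_inv k l]; ring
    rw [e']
    simp only [e]
    simp only [Finset.sum_mul, Finset.mul_sum]
    rw [Finset.sum_comm]
    refine Finset.sum_congr rfl fun c _ => ?_
    rw [Finset.sum_comm]
    exact Finset.sum_congr rfl fun b _ => Finset.sum_congr rfl fun k _ => by ring
  · simp only [J.raise, raise2, Finset.sum_mul, Finset.mul_sum]
    rw [Finset.sum_comm]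
    conv_rhs => rw [Finset.sum_comm]
    refine Finset.sum_congr rfl fun b _ => ?_
    rw [Finset.sum_comm]
    refine Finset.sum_congr rfl fun c _ => ?_
    rw [Finset.sum_comm]
    exact Finset.sum_congr rfl fun l _ => Finset.sum_congr rfl fun k _ => by
      rw [J.inv.symm_inv b c, J.inv.symm_inv k l]; ring

/-- Pair symmetry of the curvature exchanges `a` and `d` while reversing the two indices contracted
with the antisymmetric `h`. -/
theorem sum_riemann_dual_anti (J : IsKillingYanoJet G I s Y h D Rl R) (a d : Fin 4) :
    ∑ k, ∑ b, Rl k a d b * raise2 I h b k = -∑ k, ∑ b, Rl k d a b * raise2 I h b k := by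
  conv_lhs => rw [Finset.sum_comm]
  simp only [← Finset.sum_neg_distrib]
  refine Finset.sum_congr rfl fun k _ => Finset.sum_congr rfl fun b _ => ?_
  rw [J.pair d k b a, J.left k d b a, J.right k d a b, raise2_anti J.dual_anti b k]
  ring

/-- On tracing once more, the Ricci term pairs a symmetric tensor with an antisymmetric one, and the
Riemann term is antisymmetric in `a, d`. What is left is `(2 + 4) tr D = 0`. -/
theorem trace_eq_zero (J : IsKillingYanoJet G I s Y h D Rl R) : ∑ b, ∑ c, I b c * D b c = 0 := by
  have h1 : ∑ a, ∑ d, I a d * ((∑ k, (∑ l, R l k l a) * ∑ m, I k m * h m d) +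
      ∑ k, ∑ b, Rl k d a b * raise2 I h b k) =
      ∑ a, ∑ d, I a d * (2 * D a d + G d a * ∑ b, ∑ c, I b c * D b c) := by
    simp only [J.trace_integrable]
  have h2 : ∑ a, ∑ d, I a d * ∑ k, ∑ b, Rl k d a b * raise2 I h b k = 0 :=
    sum_sum_eq_zero (fun a b => J.inv.symm_inv b a) fun a d => J.sum_riemann_dual_anti a d
  have h3 : ∑ a, ∑ d, I a d * ∑ k, (∑ l, R l k l a) * ∑ m, I k m * h m d = 0 := by
    rw [← sum_sum_eq_zero (A := fun a k => ∑ l, R l k l a) (B := fun a k => raise2 I h k a)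
      (fun a k => J.ricci_symm k a) fun a k => raise2_anti J.dual_anti k a]
    refine Finset.sum_congr rfl fun a _ => ?_
    simp only [raise2, Finset.mul_sum]
    rw [Finset.sum_comm]
    refine Finset.sum_congr rfl fun k _ => ?_
    rw [Finset.sum_comm]
    exact Finset.sum_congr rfl fun m _ => Finset.sum_congr rfl fun d _ => by ring
  have h4 : ∑ a, ∑ d, I a d * (G d a * ∑ b, ∑ c, I b c * D b c) =
      4 * ∑ b, ∑ c, I b c * D b c := by
    simp only [← mul_assoc, ← Finset.sum_mul, J.inv.inv_mul]
    simp
  have h5 : ∑ a, ∑ d, I a d * (2 * D a d) = 2 * ∑ b, ∑ c, I b c * D b c := by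
    simp only [Finset.mul_sum, mul_left_comm _ (2 : ℝ)]
  simp only [mul_add, Finset.sum_add_distrib, h2, h3, h4, h5] at h1
  linarith

/-- The symmetric part of `∇ξ`. -/
theorem add_swap (J : IsKillingYanoJet G I s Y h D Rl R) (a d : Fin 4) :
    D a d + D d a = (1 / 2) * ((∑ k, (∑ l, R l k l a) * ∑ m, I k m * h m d) +
      ∑ k, (∑ l, R l k l d) * ∑ m, I k m * h m a) := by
  have h1 := J.trace_integrable a d
  have h2 := J.trace_integrable d a
  rw [J.trace_eq_zero] at h1 h2
  linarith [J.sum_riemann_dual_anti a d]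

theorem riemann_mul_inv (J : IsKillingYanoJet G I s Y h D Rl R) (a b c d : Fin 4) :
    ∑ l, R c l a b * I l d = -∑ l, R d l a b * I l c := by
  simp only [J.raise, Finset.sum_mul, ← Finset.sum_neg_distrib]
  rw [Finset.sum_comm]
  exact Finset.sum_congr rfl fun k _ => Finset.sum_congr rfl fun l _ => by
    rw [J.left l k, J.inv.symm_inv c k, J.inv.symm_inv d l]; ring

theorem riemann_trace (J : IsKillingYanoJet G I s Y h D Rl R) (a b : Fin 4) :
    ∑ l, R l l a b = 0 := by
  simp only [J.raise]
  exact sum_sum_eq_zero (A := I) (B := fun l k => Rl k l a b) (fun a b => J.inv.symm_inv b a)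
    fun l k => J.left k l a b

/-- The right side is arranged so that `a, b` occupy a pair of slots of `ε`, ready for the second
dualization. -/
theorem hodge_integrable (J : IsKillingYanoJet G I s Y h D Rl R) (a b c d : Fin 4) :
    hodge s I (deriv2 (fun l m => R l m a b) h) c d =
      ∑ l, s a b l d * (∑ m, I l m * D c m) + ∑ l, s a b c l * ∑ m, I l m * D d m := by
  generalize hE : (fun l c => ∑ m, I l m * D c m) = E
  have hE' : ∀ l c, ∑ m, I l m * D c m = E l c := fun l c => congrFun (congrFun hE l) c
  have htr : ∑ l, E l l = 0 := by simp only [← hE', J.trace_eq_zero]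
  have e1 : ∀ a b k t, ∑ l, ∑ m, I k l * I t m * (G l b * D a m) =
      (if k = b then 1 else 0) * E t a := fun a b k t => by
    rw [← J.inv.inv_mul k b, ← hE', Finset.sum_mul]
    exact Finset.sum_congr rfl fun l _ => by
      rw [Finset.mul_sum]
      exact Finset.sum_congr rfl fun m _ => by ring
  have e2 : ∀ a b k t, ∑ l, ∑ m, I k l * I t m * (G m b * D a l) =
      (if t = b then 1 else 0) * E k a := fun a b k t => by
    rw [← e1 a b t k, Finset.sum_comm]
    exact Finset.sum_congr rfl fun l _ => Finset.sum_congr rfl fun m _ => by ring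
  have hr : ∀ k t, raise2 I (deriv2 (fun l m => R l m a b) h) k t =
      (if k = b then 1 else 0) * E t a - (if t = b then 1 else 0) * E k a
      - (if k = a then 1 else 0) * E t b + (if t = a then 1 else 0) * E k b := fun k t => by
    simp only [raise2, J.integrable, mul_sub, mul_add, Finset.sum_sub_distrib,
      Finset.sum_add_distrib, e1, e2]
  -- The direct computation puts `E` on the slots `a, b` of `ε`. Since `E` is trace-free, this
  -- identity moves it to the slots `c, d`.
  have h2 := J.alt.sum_derivation E c d b a
  rw [hodge_eq_sum_raise2]
  simp only [hr, hE', mul_sub, mul_add, Finset.sum_sub_distrib, Finset.sum_add_distrib, ite_mul,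
    one_mul, zero_mul, mul_ite, mul_zero, Finset.sum_ite_eq', Finset.mem_univ, if_true,
    Finset.sum_ite_irrel, Finset.sum_const_zero]
  rw [htr] at h2
  have s1 : ∀ l, s c d l b = -s c d b l := fun l => J.alt.swap23 c d b l
  have s2 : ∀ l, s c d l a = -s c d a l := fun l => J.alt.swap23 c d a l
  have t1 : ∀ l, E l c * s l d b a = -(s a b l d * E l c) := fun l => by
    rw [J.alt.rotate b a l d, J.alt.swap01 a b l d]; ring
  have t2 : ∀ l, E l d * s c l b a = -(s a b c l * E l d) := fun l => by
    rw [J.alt.rotate b a c l, J.alt.swap01 a b c l]; ring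
  have t3 : ∀ l, E l b * s c d l a = -(s c d a l * E l b) := fun l => by rw [s2]; ring
  have t4 : ∀ l, E l a * s c d b l = s c d b l * E l a := fun l => mul_comm _ _
  simp only [t1, t2, t3, t4, Finset.sum_neg_distrib] at h2
  simp only [s1, s2, neg_mul, Finset.sum_neg_distrib]
  linarith

/-- The dualized integrability condition of `Y`. -/
theorem dual_integrable (J : IsKillingYanoJet G I s Y h D Rl R) (c d e f : Fin 4) :
    ∑ l, hodge s I (R l c) e f * Y l d + ∑ l, hodge s I (R l d) e f * Y c l =
      G e c * D d f - G e d * D c f - G f c * D d e + G f d * D c e := by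
  -- `** = -1` recovers `Y` from `h`, so the dual of the condition on `h` is a condition on `Y`.
  have hY : ∀ a b, Y a b = -hodge s I h a b := fun a b => by
    rw [J.dual, hodge_hodge J.alt J.sq J.inv J.anti, neg_neg]
  have h1 : ∀ a b, (∑ l, R l c a b * Y l d) + ∑ l, R l d a b * Y c l =
      (∑ l, s a b l d * (-∑ m, I l m * D c m)) + ∑ l, s a b c l * -∑ m, I l m * D d m := by
    intro a b
    have h2 := hodge_deriv2 J.alt (F := fun l m => R l m a b) J.inv.symm_inv
      (J.riemann_mul_inv a b) (J.riemann_trace a b) h c d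
    rw [J.hodge_integrable] at h2
    simp only [hY, mul_neg, Finset.sum_neg_distrib]
    simp only [deriv2] at h2
    linarith
  -- The second dualization, in the curvature pair: each `ε` on the right contracts to a minor of
  -- the metric.
  rw [← hodge_sum_mul (fun l => R l c), ← hodge_sum_mul (fun l => R l d), ← hodge_add]
  simp only [h1]
  rw [hodge_add, hodge_sum_mul (fun l a b => s a b l d), hodge_sum_mul (fun l a b => s a b c l)]
  simp only [hodge_symbol J.alt J.sq J.inv, minor2, neg_mul_neg, sub_mul, Finset.sum_sub_distrib]
  have h4 : ∀ a b k d, ∑ l, G b k * G a l * ∑ m, I l m * D d m = G b k * D d a := fun a b k d => by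
    rw [← J.inv.sum_lower_raise a (D d), Finset.mul_sum]
    exact Finset.sum_congr rfl fun l _ => by ring
  have h3 : ∀ a b k d, ∑ l, G a l * G b k * ∑ m, I l m * D d m = G b k * D d a := fun a b k d => by
    rw [← J.inv.sum_lower_raise a (D d), Finset.mul_sum]
    exact Finset.sum_congr rfl fun l _ => by ring
  simp only [h3, h4]
  ring

end IsKillingYanoJet
end Spacetime

/-! ### The central identity at a point. -/

namespace Spacetime

/-- `A` with its first index raised by `I`. -/
def raise1 (I A : Fin 4 → Fin 4 → ℝ) (l b : Fin 4) : ℝ := ∑ k, I l k * A k b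

/-- The Einstein tensor of the Riemann tensor `R`. -/
noncomputable def einsteinAt (G I : Fin 4 → Fin 4 → ℝ) (R : Fin 4 → Fin 4 → Fin 4 → Fin 4 → ℝ)
    (m n : Fin 4) : ℝ :=
  ∑ l, R l m l n - (∑ a, ∑ b, I a b * ∑ l, R l a l b) / 2 * G m n

/-- `A^l_γ G_{δl}`, with `E` the Einstein tensor. -/
def raiseMul (I A E : Fin 4 → Fin 4 → ℝ) (c d : Fin 4) : ℝ := ∑ l, raise1 I A l c * E d l

theorem IsInv.sum_mul_raise1 {G I : Fin 4 → Fin 4 → ℝ} (hI : IsInv G I) (A : Fin 4 → Fin 4 → ℝ)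
    (a b : Fin 4) : ∑ k, raise1 I A k b * G a k = A a b := by
  rw [← hI.sum_lower_raise a fun k => A k b]
  exact Finset.sum_congr rfl fun k _ => by rw [raise1, mul_comm]

namespace IsKillingYanoJet

variable {G I Y h D : Fin 4 → Fin 4 → ℝ} {s Rl R : Fin 4 → Fin 4 → Fin 4 → Fin 4 → ℝ}

theorem einsteinAt_symm (J : IsKillingYanoJet G I s Y h D Rl R) (a b : Fin 4) :
    einsteinAt G I R b a = einsteinAt G I R a b := by
  rw [einsteinAt, einsteinAt, J.ricci_symm a b, J.inv.symm a b]

theorem add_swap_einstein (J : IsKillingYanoJet G I s Y h D Rl R) (a d : Fin 4) :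
    D a d + D d a = (1 / 2) * (raiseMul I h (einsteinAt G I R) a d +
      raiseMul I h (einsteinAt G I R) d a) := by
  have e : ∀ a d, raiseMul I h (einsteinAt G I R) a d = (∑ k, (∑ l, R l k l d) *
      ∑ m, I k m * h m a) - (∑ a, ∑ b, I a b * ∑ l, R l a l b) / 2 * h d a := fun a d => by
    rw [← J.inv.sum_mul_raise1 h d a, Finset.mul_sum, ← Finset.sum_sub_distrib]
    exact Finset.sum_congr rfl fun k _ => by
      rw [einsteinAt, J.ricci_symm k d, raise1]; ring
  rw [J.add_swap, e, e, J.dual_anti a d]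
  ring

theorem riemannDual_lower_anti (J : IsKillingYanoJet G I s Y h D Rl R) (l m e f : Fin 4) :
    hodge s I (Rl m l) e f = -hodge s I (Rl l m) e f := by
  have : Rl m l = fun a b => -Rl l m a b := by funext a b; exact J.left l m a b
  rw [this]
  simp only [hodge, mul_neg, Finset.sum_neg_distrib]

theorem riemannDual_raise (J : IsKillingYanoJet G I s Y h D Rl R) (l m e f : Fin 4) :
    hodge s I (R l m) e f = ∑ k, I l k * hodge s I (Rl k m) e f := by
  have : R l m = fun a b => ∑ k, Rl k m a b * I l k := by
    funext a b; rw [J.raise]; exact Finset.sum_congr rfl fun k _ => mul_comm _ _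
  rw [this, hodge_sum_mul (fun k => Rl k m)]
  exact Finset.sum_congr rfl fun k _ => mul_comm _ _

theorem sum_mul_raise1_anti (J : IsKillingYanoJet G I s Y h D Rl R) (c l : Fin 4) :
    ∑ k, Y c k * I k l = -raise1 I Y l c := by
  rw [raise1, ← Finset.sum_neg_distrib]
  exact Finset.sum_congr rfl fun k _ => by rw [J.anti k c, J.inv.symm_inv k l]; ring

/-- The dual acts only on the second pair, so `R*` stays antisymmetric in its first pair, and both
of those indices are contracted with a `Y`. The symmetrization of the central identity therefore
kills this term. -/
theorem sum_riemannDual_anti (J : IsKillingYanoJet G I s Y h D Rl R) (b c d a : Fin 4) :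
    ∑ k, raise1 I Y k c * ∑ l, hodge s I (R l k) d a * Y b l =
      -∑ k, raise1 I Y k b * ∑ l, hodge s I (R l k) d a * Y c l := by
  have e : ∀ b k, ∑ l, hodge s I (R l k) d a * Y b l =
      -∑ m, raise1 I Y m b * hodge s I (Rl m k) d a := fun b k => by
    simp only [J.riemannDual_raise, Finset.sum_mul]
    rw [Finset.sum_comm, ← Finset.sum_neg_distrib]
    refine Finset.sum_congr rfl fun m _ => ?_
    rw [← neg_mul, ← J.sum_mul_raise1_anti, Finset.sum_mul]
    exact Finset.sum_congr rfl fun l _ => by rw [J.inv.symm_inv l m]; ring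
  simp only [e, mul_neg, Finset.sum_neg_distrib, neg_neg, Finset.mul_sum]
  rw [Finset.sum_comm, ← Finset.sum_neg_distrib]
  refine Finset.sum_congr rfl fun m _ => ?_
  rw [← Finset.sum_neg_distrib]
  exact Finset.sum_congr rfl fun k _ => by rw [J.riemannDual_lower_anti m k]; ring

/-- `K_{λb} R*^λ_{cda}` before symmetrization. -/
theorem sum_tensorK_mul (J : IsKillingYanoJet G I s Y h D Rl R) (b c d a : Fin 4) :
    ∑ l, (∑ k, Y l k * raise1 I Y k b) * hodge s I (R l c) d a =
      G d c * (∑ k, raise1 I Y k b * D k a) - Y d b * D c a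
        - G a c * (∑ k, raise1 I Y k b * D k d) + Y a b * D c d
        - ∑ k, raise1 I Y k b * ∑ l, hodge s I (R l k) d a * Y c l := by
  have h1 : ∑ l, (∑ k, Y l k * raise1 I Y k b) * hodge s I (R l c) d a =
      ∑ k, raise1 I Y k b * ∑ l, hodge s I (R l c) d a * Y l k := by
    simp only [Finset.sum_mul, Finset.mul_sum]
    rw [Finset.sum_comm]
    exact Finset.sum_congr rfl fun k _ => Finset.sum_congr rfl fun l _ => by ring
  -- The dualized condition moves the curvature action from the index `c` to the index `k`, leaving
  -- terms in `D`.
  have h2 : ∀ k, ∑ l, hodge s I (R l c) d a * Y l k =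
      (G d c * D k a - G d k * D c a - G a c * D k d + G a k * D c d) -
        ∑ l, hodge s I (R l k) d a * Y c l := fun k => by
    rw [← J.dual_integrable c k d a]; ring
  rw [h1]
  simp only [h2, mul_sub, mul_add, Finset.sum_sub_distrib, Finset.sum_add_distrib]
  have e1 : ∀ p q r, ∑ k, raise1 I Y k b * (G p q * D k r) = G p q * ∑ k, raise1 I Y k b * D k r :=
    fun p q r => by
      rw [Finset.mul_sum]; exact Finset.sum_congr rfl fun k _ => by ring
  have e2 : ∀ p q r, ∑ k, raise1 I Y k b * (G p k * D q r) = Y p b * D q r := fun p q r => by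
    rw [← J.inv.sum_mul_raise1 Y p b, Finset.sum_mul]
    exact Finset.sum_congr rfl fun k _ => by ring
  simp only [e1, e2]

theorem central_identity (J : IsKillingYanoJet G I s Y h D Rl R) (b c d a : Fin 4) :
    sym3 (fun b c d => ∑ l, (∑ k, Y l k * raise1 I Y k b) * hodge s I (R l c) d a) b c d =
      sym3 (fun b c d => ∑ l, raise1 I Y l b * G c d * D l a) b c d
      - sym3 (fun b c d => ∑ l, G a b * raise1 I Y l c * D l d) b c d
      + (1 / 2) * sym3 (fun b c d => ∑ l, Y a b * raise1 I h l c * einsteinAt G I R d l) b c d := by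
  simp only [J.sum_tensorK_mul]
  have e1 : ∀ b c d, ∑ l, raise1 I Y l b * G c d * D l a = G c d * ∑ l, raise1 I Y l b * D l a :=
    fun b c d => by
      rw [Finset.mul_sum]; exact Finset.sum_congr rfl fun k _ => by ring
  have e2 : ∀ b c d, ∑ l, G a b * raise1 I Y l c * D l d = G a b * ∑ l, raise1 I Y l c * D l d :=
    fun b c d => by
      rw [Finset.mul_sum]; exact Finset.sum_congr rfl fun k _ => by ring
  have e3 : ∀ b c d, ∑ l, Y a b * raise1 I h l c * einsteinAt G I R d l =
      Y a b * raiseMul I h (einsteinAt G I R) c d := fun b c d => by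
    rw [raiseMul, Finset.mul_sum]; exact Finset.sum_congr rfl fun k _ => by ring
  simp only [e1, e2, e3, sym3]
  have hV := fun b c d => J.sum_riemannDual_anti b c d a
  rw [hV b c d, hV b d c, hV c d b, J.anti b c, J.anti b d, J.anti c d, J.inv.symm c b,
    J.inv.symm d b, J.inv.symm d c]
  -- After `Y_{db} D_{ca}` cancels by antisymmetry, only `Y_{ab} D_{cd}` is left to match. Each
  -- factor `Y_{a·}` meets the symmetric part of `D` in the other two indices.
  linear_combination (1 / 6) * Y a b * J.add_swap_einstein c d +
    (1 / 6) * Y a c * J.add_swap_einstein b d + (1 / 6) * Y a d * J.add_swap_einstein b c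

end IsKillingYanoJet
end Spacetime

/-! ### Traces of the dual curvature and the contracted identity. -/

namespace Spacetime

theorem IsAlt4.sum_cyclic_eq_zero {s : Fin 4 → Fin 4 → Fin 4 → Fin 4 → ℝ} (hs : IsAlt4 s)
    {V : Fin 4 → Fin 4 → Fin 4 → ℝ} (hV : ∀ a b c, V a b c + V b c a + V c a b = 0) (e : Fin 4) :
    ∑ a, ∑ b, ∑ c, s e a b c * V a b c = 0 := by
  have r : ∀ a b c, s e b c a = s e a b c := fun a b c => by
    rw [hs.swap23 e b a c, hs.swap12 e a b c, neg_neg]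
  have h1 : ∑ a, ∑ b, ∑ c, s e a b c * V b c a = ∑ a, ∑ b, ∑ c, s e a b c * V a b c := by
    rw [Finset.sum_comm, Finset.sum_congr rfl fun b _ => Finset.sum_comm]
    exact Finset.sum_congr rfl fun b _ => Finset.sum_congr rfl fun c _ =>
      Finset.sum_congr rfl fun a _ => by rw [r a b c]
  have h2 : ∑ a, ∑ b, ∑ c, s e a b c * V c a b = ∑ a, ∑ b, ∑ c, s e a b c * V a b c := by
    conv_rhs => rw [Finset.sum_comm, Finset.sum_congr rfl fun b _ => Finset.sum_comm]
    exact Finset.sum_congr rfl fun a _ => Finset.sum_congr rfl fun b _ =>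
      Finset.sum_congr rfl fun c _ => by rw [r c a b]
  have h3 : ∑ a, ∑ b, ∑ c, s e a b c * (V a b c + V b c a + V c a b) = 0 := by simp [hV]
  simp only [mul_add, Finset.sum_add_distrib, h1, h2] at h3
  linarith

namespace IsKillingYanoJet

variable {G I Y h D : Fin 4 → Fin 4 → ℝ} {s Rl R : Fin 4 → Fin 4 → Fin 4 → Fin 4 → ℝ}

/-- The first Bianchi identity: `ε` is contracted with three curvature indices whose cyclic sum
vanishes. -/
theorem trace_riemannDual_lower (J : IsKillingYanoJet G I s Y h D Rl R) (m e : Fin 4) :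
    ∑ c, ∑ f, I c f * hodge s I (Rl m c) e f = 0 := by
  have hV : ∀ f k t, (∑ c, I f c * raise2 I (Rl m c) k t) + (∑ c, I k c * raise2 I (Rl m c) t f) +
      ∑ c, I t c * raise2 I (Rl m c) f k = 0 := by
    intro f k t
    have h1 : ∑ c, I k c * raise2 I (Rl m c) t f =
        ∑ c, ∑ r, ∑ q, I f c * I k r * I t q * Rl m r q c := by
      simp only [raise2, Finset.mul_sum]
      rw [Finset.sum_congr rfl fun c _ => Finset.sum_comm, Finset.sum_comm]
      exact Finset.sum_congr rfl fun c _ => Finset.sum_congr rfl fun r _ =>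
        Finset.sum_congr rfl fun q _ => by ring
    have h2 : ∑ c, I t c * raise2 I (Rl m c) f k =
        ∑ c, ∑ r, ∑ q, I f c * I k r * I t q * Rl m q c r := by
      simp only [raise2, Finset.mul_sum]
      rw [Finset.sum_comm, Finset.sum_congr rfl fun c _ => Finset.sum_comm]
      exact Finset.sum_congr rfl fun c _ => Finset.sum_congr rfl fun r _ =>
        Finset.sum_congr rfl fun q _ => by ring
    have h3 : ∑ c, I f c * raise2 I (Rl m c) k t =
        ∑ c, ∑ r, ∑ q, I f c * I k r * I t q * Rl m c r q := by
      simp only [raise2, Finset.mul_sum, mul_assoc]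
    rw [h1, h2, h3]
    simp only [← Finset.sum_add_distrib, ← mul_add, J.cyclic, mul_zero, Finset.sum_const_zero]
  have h := J.alt.sum_cyclic_eq_zero hV e
  have h2 : ∑ c, ∑ f, I c f * hodge s I (Rl m c) e f =
      (1 / 2) * ∑ f, ∑ k, ∑ t, s e f k t * ∑ c, I f c * raise2 I (Rl m c) k t := by
    simp only [hodge_eq_sum_raise2, Finset.mul_sum]
    rw [Finset.sum_comm]
    refine Finset.sum_congr rfl fun f _ => ?_
    rw [Finset.sum_comm]
    refine Finset.sum_congr rfl fun k _ => ?_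
    rw [Finset.sum_comm]
    exact Finset.sum_congr rfl fun t _ => Finset.sum_congr rfl fun c _ => by
      rw [J.inv.symm_inv c f]; ring
  rw [h2, h, mul_zero]

theorem trace_riemannDual (J : IsKillingYanoJet G I s Y h D Rl R) (l e : Fin 4) :
    ∑ c, ∑ f, I c f * hodge s I (R l c) e f = 0 := by
  simp only [J.riemannDual_raise, Finset.mul_sum]
  rw [Finset.sum_congr rfl fun c _ => Finset.sum_comm, Finset.sum_comm]
  refine Finset.sum_eq_zero fun k _ => ?_
  rw [← mul_zero (I l k), ← J.trace_riemannDual_lower k e]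
  simp only [Finset.mul_sum]
  exact Finset.sum_congr rfl fun c _ => Finset.sum_congr rfl fun f _ => by ring

/-- The trace of the dualized integrability condition. -/
theorem sum_riemannDual_mul_raise1 (J : IsKillingYanoJet G I s Y h D Rl R) (d e : Fin 4) :
    ∑ f, ∑ l, hodge s I (R l d) e f * raise1 I Y f l = -2 * D d e := by
  have h1 : ∑ c, ∑ f, I c f * (∑ l, hodge s I (R l c) e f * Y l d +
      ∑ l, hodge s I (R l d) e f * Y c l) = -2 * D d e := by
    simp only [J.dual_integrable]
    have e1 : ∑ c, ∑ f, I c f * (G e c * D d f) = D d e := by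
      rw [← J.inv.sum_lower_raise e (D d)]
      exact Finset.sum_congr rfl fun c _ => by
        rw [Finset.mul_sum]
        exact Finset.sum_congr rfl fun f _ => by ring
    have e2 : ∑ c, ∑ f, I c f * (G e d * D c f) = 0 := by
      rw [← mul_zero (G e d), ← J.trace_eq_zero]
      simp only [Finset.mul_sum]
      exact Finset.sum_congr rfl fun c _ => Finset.sum_congr rfl fun f _ => by ring
    have e3 : ∑ c, ∑ f, I c f * (G f c * D d e) = 4 * D d e := by
      simp only [← mul_assoc, ← Finset.sum_mul, J.inv.inv_mul]
      simp
    have e4 : ∑ c, ∑ f, I c f * (G f d * D c e) = D d e := by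
      simp only [← mul_assoc, ← Finset.sum_mul, J.inv.inv_mul]
      simp
    -- The four terms count `1 - 0 - 4 + 1 = -2` copies of `D d e`.
    simp only [mul_sub, mul_add, Finset.sum_sub_distrib, Finset.sum_add_distrib, e1, e2, e3, e4]
    ring
  have h2 : ∑ c, ∑ f, I c f * ∑ l, hodge s I (R l c) e f * Y l d = 0 := by
    simp only [Finset.mul_sum]
    rw [Finset.sum_congr rfl fun c _ => Finset.sum_comm, Finset.sum_comm]
    refine Finset.sum_eq_zero fun l _ => ?_
    rw [← zero_mul (Y l d), ← J.trace_riemannDual l e]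
    simp only [Finset.sum_mul]
    exact Finset.sum_congr rfl fun c _ => Finset.sum_congr rfl fun f _ => by ring
  simp only [mul_add, Finset.sum_add_distrib] at h1
  rw [h2, zero_add] at h1
  rw [← h1]
  simp only [raise1, Finset.mul_sum]
  rw [Finset.sum_congr rfl fun f _ => Finset.sum_comm, Finset.sum_comm]
  exact Finset.sum_congr rfl fun c _ => Finset.sum_congr rfl fun f _ =>
    Finset.sum_congr rfl fun l _ => by rw [J.inv.symm_inv f c]; ring

theorem raise2_eq_sum (A : Fin 4 → Fin 4 → ℝ) (k t : Fin 4) :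
    raise2 I A k t = ∑ m, raise1 I A k m * I t m := by
  simp only [raise2, raise1, Finset.sum_mul]
  rw [Finset.sum_comm]
  exact Finset.sum_congr rfl fun m _ => Finset.sum_congr rfl fun l _ => by ring

theorem sum_raise2_mul (J : IsKillingYanoJet G I s Y h D Rl R) (A : Fin 4 → Fin 4 → ℝ)
    (k n : Fin 4) : ∑ a, raise2 I A k a * G a n = raise1 I A k n := by
  simp only [raise2_eq_sum, Finset.sum_mul]
  rw [Finset.sum_comm]
  have : ∀ m, ∑ a, raise1 I A k m * I a m * G a n = raise1 I A k m * if m = n then 1 else 0 :=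
    fun m => by
      rw [← J.inv.inv_mul m n, Finset.mul_sum]
      exact Finset.sum_congr rfl fun a _ => by rw [J.inv.symm_inv a m]; ring
  simp [this]

theorem sum_raise2_mul_riemannDual_lower (J : IsKillingYanoJet G I s Y h D Rl R) (d e : Fin 4) :
    ∑ k, ∑ f, raise2 I Y k f * hodge s I (Rl d k) e f = -2 * D d e := by
  rw [← J.sum_riemannDual_mul_raise1 d e, Finset.sum_comm]
  refine Finset.sum_congr rfl fun f _ => ?_
  simp only [J.riemannDual_raise, Finset.sum_mul]
  rw [Finset.sum_comm]
  refine Finset.sum_congr rfl fun k _ => ?_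
  rw [J.riemannDual_lower_anti k d, raise2_anti J.anti f k, raise2_eq_sum, neg_mul_neg,
    Finset.sum_mul]
  exact Finset.sum_congr rfl fun l _ => by rw [J.inv.symm_inv k l]; ring

theorem sum_mul_sum_raise2_riemannDual (J : IsKillingYanoJet G I s Y h D Rl R) (n e : Fin 4) :
    ∑ k, ∑ f, raise2 I Y k f * ∑ l, hodge s I (R l k) e f * Y n l =
      2 * ∑ d, raise1 I Y d n * D d e := by
  calc _ = ∑ l, Y n l * ∑ d, I l d * ∑ k, ∑ f, raise2 I Y k f * hodge s I (Rl d k) e f := by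
        simp only [J.riemannDual_raise, Finset.mul_sum, Finset.sum_mul]
        rw [Finset.sum_congr rfl fun k _ => Finset.sum_comm, Finset.sum_comm]
        refine Finset.sum_congr rfl fun l _ => ?_
        rw [Finset.sum_congr rfl fun k _ => Finset.sum_comm, Finset.sum_comm]
        exact Finset.sum_congr rfl fun d _ => Finset.sum_congr rfl fun k _ =>
          Finset.sum_congr rfl fun f _ => by ring
    _ = _ := by
        simp only [J.sum_raise2_mul_riemannDual_lower, Finset.mul_sum]
        rw [Finset.sum_comm]
        refine Finset.sum_congr rfl fun d _ => ?_
        rw [← neg_neg (raise1 I Y d n), ← J.sum_mul_raise1_anti, ← Finset.sum_neg_distrib,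
          Finset.sum_mul, Finset.mul_sum]
        exact Finset.sum_congr rfl fun l _ => by ring

/-- The mixed-index form of `sum_hodge_mul_raise2`; the minus sign comes from reversing the indices
of `Y`. This is the source of `𝒵 G_{μν}`. -/
theorem sum_raise1_mul_raise1 (J : IsKillingYanoJet G I s Y h D Rl R) (l n : Fin 4) :
    ∑ k, raise1 I h l k * raise1 I Y k n =
      if l = n then -((1 / 4) * ∑ a, ∑ b, h a b * raise2 I Y a b) else 0 := by
  generalize hZ : (1 / 4) * ∑ a, ∑ b, h a b * raise2 I Y a b = Z
  have h1 : ∀ m a, ∑ k, h m k * raise2 I Y k a = if m = a then -Z else 0 := fun m a => by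
    have := sum_hodge_mul_raise2 (I := I) J.alt J.anti m a
    rw [← J.dual, hZ] at this
    rw [show (if m = a then -Z else 0) = -(if m = a then Z else 0) by split_ifs <;> simp, ← this,
      ← Finset.sum_neg_distrib]
    exact Finset.sum_congr rfl fun k _ => by rw [raise2_anti J.anti a k]; ring
  have h3 : ∀ m, ∑ k, h m k * raise1 I Y k n = -Z * G m n := fun m => by
    simp only [← J.sum_raise2_mul, Finset.mul_sum, ← mul_assoc]
    rw [Finset.sum_comm]
    simp [← Finset.sum_mul, h1]
  have h4 : ∑ k, raise1 I h l k * raise1 I Y k n = -Z * ∑ m, I l m * G m n := by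
    simp only [raise1.eq_1 I h, Finset.sum_mul, Finset.mul_sum]
    rw [Finset.sum_comm]
    refine Finset.sum_congr rfl fun m _ => ?_
    rw [mul_left_comm, ← h3, Finset.mul_sum]
    exact Finset.sum_congr rfl fun k _ => by ring
  rw [h4, J.inv.inv_mul]
  split_ifs <;> simp

/-- The contraction `R*^λ_{nμ}^ρ K_{λρ}` in terms of `∇ξ`. -/
theorem contracted_identity (J : IsKillingYanoJet G I s Y h D Rl R) (m n : Fin 4) :
    ∑ l, ∑ r, ∑ q, I r q * hodge s I (R l n) m q * ∑ k, Y l k * raise1 I Y k r =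
      G m n * (∑ k, ∑ q, raise2 I Y k q * D k q) + (∑ q, raise1 I Y q m * D n q)
        - 3 * ∑ k, raise1 I Y k n * D k m := by
  have h1 : ∑ l, ∑ r, ∑ q, I r q * hodge s I (R l n) m q * ∑ k, Y l k * raise1 I Y k r =
      ∑ k, ∑ q, raise2 I Y k q * ∑ l, hodge s I (R l n) m q * Y l k := by
    simp only [raise2_eq_sum, Finset.mul_sum, Finset.sum_mul]
    calc _ = ∑ l, ∑ r, ∑ k, ∑ q, I r q * hodge s I (R l n) m q * (Y l k * raise1 I Y k r) :=
          Finset.sum_congr rfl fun l _ => Finset.sum_congr rfl fun r _ => Finset.sum_comm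
      _ = ∑ l, ∑ k, ∑ r, ∑ q, I r q * hodge s I (R l n) m q * (Y l k * raise1 I Y k r) :=
          Finset.sum_congr rfl fun l _ => Finset.sum_comm
      _ = ∑ k, ∑ l, ∑ r, ∑ q, I r q * hodge s I (R l n) m q * (Y l k * raise1 I Y k r) :=
          Finset.sum_comm
      _ = ∑ k, ∑ l, ∑ q, ∑ r, I r q * hodge s I (R l n) m q * (Y l k * raise1 I Y k r) :=
          Finset.sum_congr rfl fun k _ => Finset.sum_congr rfl fun l _ => Finset.sum_comm
      _ = ∑ k, ∑ q, ∑ l, ∑ r, I r q * hodge s I (R l n) m q * (Y l k * raise1 I Y k r) :=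
          Finset.sum_congr rfl fun k _ => Finset.sum_comm
      _ = _ := Finset.sum_congr rfl fun k _ => Finset.sum_congr rfl fun q _ =>
          Finset.sum_congr rfl fun l _ => Finset.sum_congr rfl fun r _ => by
            rw [J.inv.symm_inv r q]; ring
  have h2 : ∀ k q, ∑ l, hodge s I (R l n) m q * Y l k =
      (G m n * D k q - G m k * D n q - G q n * D k m + G q k * D n m) -
        ∑ l, hodge s I (R l k) m q * Y n l := fun k q => by
    rw [← J.dual_integrable n k m q]; ring
  rw [h1]
  simp only [h2, mul_sub, mul_add, Finset.sum_sub_distrib, Finset.sum_add_distrib,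
    J.sum_mul_sum_raise2_riemannDual]
  have e1 : ∑ k, ∑ q, raise2 I Y k q * (G m n * D k q) =
      G m n * ∑ k, ∑ q, raise2 I Y k q * D k q := by
    simp only [Finset.mul_sum]
    exact Finset.sum_congr rfl fun k _ => Finset.sum_congr rfl fun q _ => by ring
  have e2 : ∑ k, ∑ q, raise2 I Y k q * (G m k * D n q) = -∑ q, raise1 I Y q m * D n q := by
    rw [Finset.sum_comm, ← Finset.sum_neg_distrib]
    refine Finset.sum_congr rfl fun q _ => ?_
    rw [← J.sum_raise2_mul, ← neg_mul, ← Finset.sum_neg_distrib, Finset.sum_mul]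
    exact Finset.sum_congr rfl fun k _ => by rw [raise2_anti J.anti q k, J.inv.symm k m]; ring
  have e3 : ∑ k, ∑ q, raise2 I Y k q * (G q n * D k m) = ∑ k, raise1 I Y k n * D k m := by
    refine Finset.sum_congr rfl fun k _ => ?_
    rw [← J.sum_raise2_mul, Finset.sum_mul]
    exact Finset.sum_congr rfl fun q _ => by ring
  have e4 : ∑ k, ∑ q, raise2 I Y k q * (G q k * D n m) = 0 := by
    rw [← sum_sum_eq_zero (A := fun k q => G q k * D n m) (fun a b => by rw [J.inv.symm a b])
      (raise2_anti (I := I) J.anti)]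
    exact Finset.sum_congr rfl fun k _ => Finset.sum_congr rfl fun q _ => mul_comm _ _
  -- The coefficient `-3` is `-1` from the term `e3` and `-2` from the contracted `Y Y R*` term.
  rw [e1, e2, e3, e4]
  ring

end IsKillingYanoJet
end Spacetime

/-! ### The reduced identity, the Ricci-flat case and the passage from the manifold to a chart. -/

namespace Spacetime

namespace IsKillingYanoJet

variable {G I Y h D : Fin 4 → Fin 4 → ℝ} {s Rl R : Fin 4 → Fin 4 → Fin 4 → Fin 4 → ℝ}

/-- `H` plays the role of the Hessian of `𝒵`. Its symmetry and the symmetric part of `D` turn both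
orders of indices in the products `Y D` into `H` plus Einstein terms, giving the coefficient `1 + 3
= 4`. -/
theorem reduced_identity (J : IsKillingYanoJet G I s Y h D Rl R) {H : Fin 4 → Fin 4 → ℝ}
    (hH : ∀ a b, H a b = ∑ l, raise1 I Y l b * D a l) (hsymm : ∀ a b, H b a = H a b)
    (m n : Fin 4) :
    ∑ l, ∑ r, ∑ q, I r q * hodge s I (R l n) m q * ∑ k, Y l k * raise1 I Y k r =
      4 * H m n - G m n * (∑ a, ∑ b, I a b * H a b)
      - ∑ r, sym2 (fun r m => ∑ l, raise1 I h l r * einsteinAt G I R m l) r m * raise1 I Y r n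
      + ∑ l, ∑ b, raise1 I (einsteinAt G I R) b l * raise1 I Y l n * h m b
      + (1 / 4) * (∑ a, ∑ b, h a b * raise2 I Y a b) * einsteinAt G I R m n := by
  have hP : ∀ c d, ∑ l, raise1 I h l c * einsteinAt G I R d l =
      raiseMul I h (einsteinAt G I R) c d := fun _ _ => rfl
  rw [J.contracted_identity]
  have e1 : ∑ a, ∑ b, I a b * H a b = -∑ k, ∑ q, raise2 I Y k q * D k q := by
    have : ∑ k, ∑ q, raise2 I Y k q * D k q = -∑ k, ∑ q, raise2 I Y q k * D k q := by
      simp only [← Finset.sum_neg_distrib]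
      exact Finset.sum_congr rfl fun k _ => Finset.sum_congr rfl fun q _ => by
        rw [raise2_anti J.anti k q]; ring
    rw [this, neg_neg]
    simp only [hH, raise2_eq_sum, Finset.mul_sum, Finset.sum_mul]
    refine Finset.sum_congr rfl fun a _ => ?_
    rw [Finset.sum_comm]
    exact Finset.sum_congr rfl fun l _ => Finset.sum_congr rfl fun b _ => by ring
  have e2 : ∑ q, raise1 I Y q m * D n q = H m n := by rw [← hH, hsymm]
  -- Exchanging the indices of `D` costs its symmetric part, which contains the Einstein tensor.
  have e3 : ∑ k, raise1 I Y k n * D k m =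
      (1 / 2) * ((∑ k, raise1 I Y k n * raiseMul I h (einsteinAt G I R) k m) +
        ∑ k, raise1 I Y k n * raiseMul I h (einsteinAt G I R) m k) - H m n := by
    rw [hH, ← Finset.sum_add_distrib, Finset.mul_sum, ← Finset.sum_sub_distrib]
    refine Finset.sum_congr rfl fun k _ => ?_
    linear_combination raise1 I Y k n * J.add_swap_einstein k m
  have e4 : ∑ k, raise1 I Y k n * raiseMul I h (einsteinAt G I R) k m =
      -((1 / 4) * ∑ a, ∑ b, h a b * raise2 I Y a b) * einsteinAt G I R m n := by
    simp only [raiseMul]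
    rw [Finset.sum_congr rfl fun k _ => Finset.mul_sum _ _ _]
    rw [Finset.sum_comm]
    have : ∀ l, ∑ k, raise1 I Y k n * (raise1 I h l k * einsteinAt G I R m l) =
        (∑ k, raise1 I h l k * raise1 I Y k n) * einsteinAt G I R m l := fun l => by
      rw [Finset.sum_mul]
      exact Finset.sum_congr rfl fun k _ => by ring
    simp only [this, J.sum_raise1_mul_raise1, ite_mul, zero_mul, Finset.sum_ite_eq',
      Finset.mem_univ, if_true]
  have e5 : ∑ l, ∑ b, raise1 I (einsteinAt G I R) b l * raise1 I Y l n * h m b =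
      -∑ k, raise1 I Y k n * raiseMul I h (einsteinAt G I R) m k := by
    rw [← Finset.sum_neg_distrib]
    refine Finset.sum_congr rfl fun l _ => ?_
    simp only [raiseMul, raise1.eq_1 I (einsteinAt G I R), raise1.eq_1 I h, Finset.mul_sum,
      Finset.sum_mul, ← Finset.sum_neg_distrib]
    rw [Finset.sum_comm]
    exact Finset.sum_congr rfl fun k _ => Finset.sum_congr rfl fun b _ => by
      rw [J.dual_anti b m, J.inv.symm_inv b k, J.einsteinAt_symm l k]; ring
  have e6 : ∑ r, sym2 (fun r m => ∑ l, raise1 I h l r * einsteinAt G I R m l) r m *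
      raise1 I Y r n = (1 / 2) * ((∑ k, raise1 I Y k n * raiseMul I h (einsteinAt G I R) k m) +
        ∑ k, raise1 I Y k n * raiseMul I h (einsteinAt G I R) m k) := by
    rw [← Finset.sum_add_distrib, Finset.mul_sum]
    exact Finset.sum_congr rfl fun k _ => by simp only [sym2, hP]; ring
  rw [e1, e2, e3, e5, e6, e4]
  ring

theorem einsteinAt_eq_zero (hR : ∀ a b, ∑ l, R l a l b = 0) (a b : Fin 4) :
    einsteinAt G I R a b = 0 := by
  simp [einsteinAt, hR]

theorem central_identity_of_ricci_flat (J : IsKillingYanoJet G I s Y h D Rl R)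
    (hR : ∀ a b, ∑ l, R l a l b = 0) {H : Fin 4 → Fin 4 → ℝ}
    (hH : ∀ a b, H a b = ∑ l, raise1 I Y l b * D a l) (b c d a : Fin 4) :
    sym3 (fun b c d => ∑ l, (∑ k, Y l k * raise1 I Y k b) * hodge s I (R l c) d a) b c d =
      -sym3 (fun b c d => H a b * G c d) b c d + sym3 (fun b c d => G a b * H c d) b c d := by
  have hD : ∀ a d, D d a = -D a d := fun a d => by
    have := J.add_swap_einstein a d
    simp only [raiseMul, einsteinAt_eq_zero hR, mul_zero, Finset.sum_const_zero, add_zero] at this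
    linarith
  have e1 : ∀ b c d, ∑ l, raise1 I Y l b * G c d * D l a = -(H a b * G c d) := fun b c d => by
    rw [hH, Finset.sum_mul, ← Finset.sum_neg_distrib]
    exact Finset.sum_congr rfl fun l _ => by rw [hD a l]; ring
  have e2 : ∀ b c d, ∑ l, G a b * raise1 I Y l c * D l d = -(G a b * H d c) := fun b c d => by
    rw [hH, Finset.mul_sum, ← Finset.sum_neg_distrib]
    exact Finset.sum_congr rfl fun l _ => by rw [hD d l]; ring
  rw [J.central_identity]
  simp only [e1, e2, einsteinAt_eq_zero hR, mul_zero, Finset.sum_const_zero, sym3]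
  ring

/-- The free curvature indices appear in the opposite order to `reduced_identity`; the symmetry of
`H` and `G` absorbs the exchange. -/
theorem reduced_identity_of_ricci_flat (J : IsKillingYanoJet G I s Y h D Rl R)
    (hR : ∀ a b, ∑ l, R l a l b = 0) {H : Fin 4 → Fin 4 → ℝ}
    (hH : ∀ a b, H a b = ∑ l, raise1 I Y l b * D a l) (hsymm : ∀ a b, H b a = H a b)
    (m n : Fin 4) :
    ∑ l, ∑ r, ∑ q, I r q * hodge s I (R l m) n q * ∑ k, Y l k * raise1 I Y k r =
      4 * H m n - G m n * ∑ a, ∑ b, I a b * H a b := by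
  rw [J.reduced_identity hH hsymm, hsymm m n, J.inv.symm n m]
  simp only [einsteinAt_eq_zero hR, raise1.eq_1 I (einsteinAt G I R), sym2, mul_zero, zero_mul,
    add_zero, sub_zero, Finset.sum_const_zero]

end IsKillingYanoJet

variable {U : Set E4} {y : E4} {g Y : Fin 4 → Fin 4 → E4 → ℝ}
  {ε : Fin 4 → Fin 4 → Fin 4 → Fin 4 → E4 → ℝ}

theorem IsChartKillingYano.isKillingYanoJet (hg : IsChartMetric U g) (hε : IsChartVolume U g ε)
    (hY : IsChartKillingYano U g Y) (hy : y ∈ U) :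
    IsKillingYanoJet (fun a b => g a b y) (fun a b => ginv g a b y) (fun a b c d => ε a b c d y)
      (fun a b => Y a b y) (fun a b => dual2 g ε Y a b y)
      (fun a b => nabla1 g (xi g ε Y) a b y) (fun l m a b => riemannLow g l m a b y)
      (fun l m a b => riemann g l m a b y) where
  inv := hg.isInv hy
  alt := hε.alt y hy
  sq := hε.sq y hy
  anti a b := hY.anti a b y hy
  dual := rfl
  left l m a b := hg.riemannLow_swap_left hy l m a b
  right l m a b := IsChartMetric.riemannLow_swap_right y l m a b
  cyclic l a b c := hg.riemannLow_cyclic hy l a b c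
  pair l m a b := hg.riemannLow_pair hy l m a b
  raise l m a b := hg.riemann_eq_sum hy l m a b
  integrable a b c d := hY.integrability hg hε hy a b c d

/-! ### From the manifold to a chart -/

section Manifold

variable {M : Type*} [TopologicalSpace M] [ChartedSpace E4 M]

theorem comp2_eq (e : OpenPartialHomeomorph M E4) (T : CovTensor M 2) (a b : Fin 4) (y : E4) :
    comp2 e T a b y = T (e.symm y) ![coordVec e y a, coordVec e y b] := by
  unfold comp2 comp
  congr 1
  ext i
  fin_cases i <;> rfl

theorem comp4_eq (e : OpenPartialHomeomorph M E4) (T : CovTensor M 4) (a b c d : Fin 4) (y : E4) :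
    comp4 e T a b c d y = T (e.symm y) fun i => coordVec e y (![a, b, c, d] i) := rfl

variable {e : OpenPartialHomeomorph M E4} {y : E4}

/-- The coordinate vectors of a chart form a basis. -/
theorem exists_basis_coordVec [IsManifold (𝓡 4) ∞ M]
    (he : e ∈ IsManifold.maximalAtlas (𝓡 4) ∞ M) (hy : y ∈ e.target) :
    ∃ b : Module.Basis (Fin 4) ℝ (TangentSpace (𝓡 4) (e.symm y)), ∀ i, b i = coordVec e y i := by
  have hd : e.MDifferentiable (𝓡 4) (𝓡 4) :=
    ⟨(contMDiffOn_of_mem_maximalAtlas he).mdifferentiableOn (by simp),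
      (contMDiffOn_symm_of_mem_maximalAtlas he).mdifferentiableOn (by simp)⟩
  let L : TangentSpace (𝓡 4) y ≃L[ℝ] TangentSpace (𝓡 4) (e.symm y) := hd.symm.mfderiv hy
  let B : Module.Basis (Fin 4) ℝ (TangentSpace (𝓡 4) y) :=
    (EuclideanSpace.basisFun (Fin 4) ℝ).toBasis
  refine ⟨B.map L.toLinearEquiv, fun i => ?_⟩
  have hB : B i = (EuclideanSpace.single i (1 : ℝ) : E4) :=
    (congrFun (EuclideanSpace.basisFun (Fin 4) ℝ).coe_toBasis i).trans
      (EuclideanSpace.basisFun_apply _ _ i)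
  rw [Module.Basis.map_apply, hB]
  rfl

theorem isChartMetric_comp2 [IsManifold (𝓡 4) ∞ M] {metric : CovTensor M 2} (hg : IsLorentzMetric metric)
    (he : e ∈ IsManifold.maximalAtlas (𝓡 4) ∞ M) : IsChartMetric e.target (comp2 e metric) where
  isOpen := e.open_target
  smooth a b := hg.1 e he _
  symm a b y _ := by rw [comp2_eq, comp2_eq, hg.2.1]
  det_ne y hy := by
    obtain ⟨b, hb⟩ := hg.2.2 (e.symm y)
    obtain ⟨B, hB⟩ := exists_basis_coordVec he hy
    have u0 : ∀ u v w : TangentSpace (𝓡 4) (e.symm y), Function.update ![u, v] 0 w = ![w, v] :=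
      fun u v w => by ext1 i; fin_cases i <;> rfl
    have u1 : ∀ u v w : TangentSpace (𝓡 4) (e.symm y), Function.update ![u, v] 1 w = ![u, w] :=
      fun u v w => by ext1 i; fin_cases i <;> rfl
    have a0 := fun u v => (metric (e.symm y)).map_update_add ![u, v] 0
    have a1 := fun u v => (metric (e.symm y)).map_update_add ![u, v] 1
    have s0 := fun u v => (metric (e.symm y)).map_update_smul ![u, v] 0
    have s1 := fun u v => (metric (e.symm y)).map_update_smul ![u, v] 1
    simp only [u0, u1] at a0 a1 s0 s1
    let F : LinearMap.BilinForm ℝ (TangentSpace (𝓡 4) (e.symm y)) :=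
      LinearMap.mk₂ ℝ (fun u v => metric (e.symm y) ![u, v])
        (fun u u' v => a0 u v u u') (fun c u v => s0 u v c u)
        (fun u v v' => a1 u v v v') (fun c u v => s1 u v c v)
    -- Nondegeneracy is independent of the basis: it is read off in the orthonormal basis and
    -- transferred to the coordinate one.
    have h1 : F.Nondegenerate := by
      refine (LinearMap.BilinForm.nondegenerate_iff_det_ne_zero b).2 ?_
      have : LinearMap.BilinForm.toMatrix b F =
          Matrix.diagonal fun i => if i = 0 then (-1 : ℝ) else 1 := by
        ext i j
        rw [LinearMap.BilinForm.toMatrix_apply, Matrix.diagonal_apply]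
        exact hb i j
      rw [this, Matrix.det_diagonal]
      simp
    have h2 := (LinearMap.BilinForm.nondegenerate_iff_det_ne_zero B).1 h1
    have h3 : LinearMap.BilinForm.toMatrix B F = Matrix.of fun a b => comp2 e metric a b y := by
      ext i j
      rw [LinearMap.BilinForm.toMatrix_apply, Matrix.of_apply, comp2_eq, hB, hB]
      rfl
    rwa [h3] at h2

theorem isChartVolume_comp4 {metric : CovTensor M 2} {vol : CovTensor M 4}
    (hε : IsVolumeForm metric vol) (he : e ∈ IsManifold.maximalAtlas (𝓡 4) ∞ M) :
    IsChartVolume e.target (comp2 e metric) (comp4 e vol) where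
  smooth a b c d := hε.1 e he _
  alt y _ := by
    let A : TangentSpace (𝓡 4) (e.symm y) [⋀^Fin 4]→ₗ[ℝ] ℝ :=
      { vol (e.symm y) with map_eq_zero_of_eq' := hε.2.1 (e.symm y) }
    have hA : ∀ a b c d, comp4 e vol a b c d y = A fun i => coordVec e y (![a, b, c, d] i) :=
      fun _ _ _ _ => rfl
    refine ⟨fun a b c d => ?_, fun a b c d => ?_, fun a b c d => ?_⟩
    · simp only [hA]
      rw [← A.map_swap _ (show (0 : Fin 4) ≠ 1 by decide)]
      congr 1; ext i; fin_cases i <;> rfl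
    · simp only [hA]
      rw [← A.map_swap _ (show (1 : Fin 4) ≠ 2 by decide)]
      congr 1; ext i; fin_cases i <;> rfl
    · simp only [hA]
      rw [← A.map_swap _ (show (2 : Fin 4) ≠ 3 by decide)]
      congr 1; ext i; fin_cases i <;> rfl
  sq y _ := by
    rw [comp4_eq, hε.2.2]
    congr 2
    ext i j
    rw [Matrix.of_apply, Matrix.of_apply, comp2_eq]
    fin_cases i <;> fin_cases j <;> rfl

theorem isChartKillingYano_comp2 {metric KY : CovTensor M 2} (hY : IsKillingYano metric KY)
    (he : e ∈ IsManifold.maximalAtlas (𝓡 4) ∞ M) :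
    IsChartKillingYano e.target (comp2 e metric) (comp2 e KY) where
  smooth a b := hY.1 e he _
  anti a b y _ := by rw [comp2_eq, comp2_eq, hY.2.1]
  killing a b c y hy := by
    have := hY.2.2 e he y hy a b c
    simp only [sym2] at this
    linarith

end Manifold
end Spacetime

theorem mainTheorem3 {M : Type*} [TopologicalSpace M] [ChartedSpace Spacetime.E4 M]
    [IsManifold (𝓡 4) ∞ M] (metric KY : Spacetime.CovTensor M 2) (vol : Spacetime.CovTensor M 4)
    (hg : Spacetime.IsLorentzMetric metric) (hε : Spacetime.IsVolumeForm metric vol)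
    (hY : Spacetime.IsKillingYano metric KY)
    (e : OpenPartialHomeomorph M Spacetime.E4) (he : e ∈ IsManifold.maximalAtlas (𝓡 4) ∞ M)
    (y : Spacetime.E4) (hy : y ∈ e.target) :
    let g := Spacetime.comp2 e metric
    let ε := Spacetime.comp4 e vol
    let Y := Spacetime.comp2 e KY
    let K := Spacetime.tensorK g Y
    let ξ := Spacetime.xi g ε Y
    let Z := Spacetime.scalarZ g ε Y
    let G := Spacetime.einstein g
    let R' := Spacetime.riemannDual g ε
    let Y' := Spacetime.dual2 g ε Y
    -- the central identity
    (∀ α β γ δ : Fin 4,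
      Spacetime.sym3 (fun β γ δ => ∑ l, K l β y * R' l γ δ α y) β γ δ =
        Spacetime.sym3 (fun β γ δ => ∑ l,
            Spacetime.raiseFst g Y l β y * g γ δ y * Spacetime.nabla1 g ξ l α y) β γ δ
        - Spacetime.sym3 (fun β γ δ => ∑ l,
            g α β y * Spacetime.raiseFst g Y l γ y * Spacetime.nabla1 g ξ l δ y) β γ δ
        + (1 / 2) * Spacetime.sym3 (fun β γ δ => ∑ l,
            Y α β y * Spacetime.raiseFst g Y' l γ y * G δ l y) β γ δ) ∧
    -- its contracted (reduced) form
    (∀ μ ν : Fin 4,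
      ∑ l, ∑ r, ∑ s, Spacetime.ginv g r s y * R' l ν μ s y * K l r y =
        4 * Spacetime.hess g Z μ ν y - g μ ν y * Spacetime.box g Z y
        - ∑ r, Spacetime.sym2 (fun r μ => ∑ l, Spacetime.raiseFst g Y' l r y * G μ l y) r μ
            * Spacetime.raiseFst g Y r ν y
        + ∑ l, ∑ b, Spacetime.raiseFst g G b l y * Spacetime.raiseFst g Y l ν y * Y' μ b y
        + Z y * G μ ν y) ∧
    -- the two identities in Ricci-flat spacetimes
    (Spacetime.IsRicciFlat metric →
      (∀ α β γ δ : Fin 4,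
        Spacetime.sym3 (fun β γ δ => ∑ l, K l β y * R' l γ δ α y) β γ δ =
          -Spacetime.sym3 (fun β γ δ => Spacetime.hess g Z α β y * g γ δ y) β γ δ
          + Spacetime.sym3 (fun β γ δ => g α β y * Spacetime.hess g Z γ δ y) β γ δ) ∧
      (∀ μ ν : Fin 4,
        ∑ l, ∑ r, ∑ s, Spacetime.ginv g r s y * R' l μ ν s y * K l r y =
          4 * Spacetime.hess g Z μ ν y - g μ ν y * Spacetime.box g Z y)) := by
  have hg' := Spacetime.isChartMetric_comp2 hg he
  have hε' := Spacetime.isChartVolume_comp4 hε he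
  have hY' := Spacetime.isChartKillingYano_comp2 hY he
  intro g ε Y K ξ Z G R' Y'
  have J := hY'.isKillingYanoJet hg' hε' hy
  have hH := hY'.hess_scalarZ hg' hε' hy
  have hs := fun a b => Spacetime.hess_symm hg' hy
    (Spacetime.contDiffOn_scalarZ hg' hε' hY'.smooth) b a
  -- The chart tensors evaluated at `y` unfold definitionally to the pointwise expressions, with
  -- `hH` supplying the Hessian of `𝒵`.
  refine ⟨fun α β γ δ => J.central_identity β γ δ α, fun μ ν => J.reduced_identity hH hs μ ν,
    fun hR => ⟨fun α β γ δ => J.central_identity_of_ricci_flat (hR e he y hy) hH β γ δ α,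
      fun μ ν => J.reduced_identity_of_ricci_flat (hR e he y hy) hH hs μ ν⟩⟩
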